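/- Let $M$ be a von Neumann algebra on a Hilbert space $H$ with a normal faithful tracial state $\tau$, and put $\|x\|_\tau=\tau(x^*x)^{1/2}$ for $x\in M$. Let $M_\infty=M\,\overline\otimes\,B(\ell^2(\mathbb Z))$ be the von Neumann algebra tensor product, with the trace $\tau_\infty=\tau\otimes\mathrm{Tr}$ given on positive elements by $\tau_\infty(X)=\sum_{i\in\mathbb Z}\tau(e_i^*Xe_i)\in[0,\infty]$, where $(e_i)_{i\in\mathbb Z}$ is the standard basis of $\ell^2(\mathbb Z)$ and $e_i^*Xe_i\in M$ is the $i$-th diagonal entry of $X$. Identify $M$ with the corner $M\otimes \mathrm{Id}_1=I_M M_\infty I_M$ of $M_\infty$, where $\mathrm{Id}_1$ is the projection onto $\mathbb C e_1$ and $I_M=1\otimes \mathrm{Id}_1$. Let $P\in M_\infty$ be a non-zero projection with $\tau_\infty(P)<\infty$, let $N=PM_\infty P$ (with unit $P$) and $\tau^N=\tau_\infty/\tau_\infty(P)$, let $w\in PM_\infty I_M$ be a partial isometry, and let $$\varepsilon=\max\{\tau(I_M-w^*w),\ \tau^N(P-ww^*)\}.$$ Then for every finite set $A$ and every projective measurement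 $\{T_a\}_{a\in A}$ on $N$ (projections $T_a\in N$ with $\sum_a T_a=P$) there is a projective measurement $\{Q_a\}_{a\in A}$ on $M$ (projections $Q_a\in M$ with $\sum_a Q_a=I_M$) such that $$\sum_{a\in A}\|Q_a-w^*T_aw\|_\tau^2\le 56\,\varepsilon .$$ -/

import Mathlib

open scoped TensorProduct InnerProductSpace ComplexOrder ENNReal

namespace TracialVN

noncomputable section

universe u v

variable {H : Type u} [NormedAddCommGroup H] [InnerProductSpace ℂ H] [CompleteSpace H]
set_option linter.unusedSectionVars false

variable {K : Type v} [NormedAddCommGroup K] [InnerProductSpace ℂ K] [CompleteSpace K]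

instance instSMulMemClass : SMulMemClass (VonNeumannAlgebra H) ℂ (H →L[ℂ] H) where
  smul_mem {s} c _ hx := s.toStarSubalgebra.smul_mem hx c

/-- A normal faithful tracial state on a von Neumann algebra `M`. Normality is the usual order
continuity: suprema of bounded increasing families of positive elements are preserved. -/
structure TracialState (M : VonNeumannAlgebra H) where
  toLinearMap : M →ₗ[ℂ] ℂ
  map_one' : toLinearMap 1 = 1
  nonneg' : ∀ x : M, 0 ≤ toLinearMap (star x * x)
  tracial' : ∀ x y : M, toLinearMap (x * y) = toLinearMap (y * x)
  faithful' : ∀ x : M, toLinearMap (star x * x) = 0 → x = 0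
  normal' : ∀ (S : Set M) (x : M), S.Nonempty → DirectedOn (· ≤ ·) S →
    (∀ s ∈ S, 0 ≤ (s : H →L[ℂ] H)) → IsLUB S x →
    IsLUB ((fun s : M => (toLinearMap s).re) '' S) (toLinearMap x).re

instance (M : VonNeumannAlgebra H) : CoeFun (TracialState M) (fun _ => M → ℂ) :=
  ⟨fun τ => τ.toLinearMap⟩

/-- The norm `‖x‖_τ = τ(x* x)^{1/2}`. -/
def TracialState.norm₂ {M : VonNeumannAlgebra H} (τ : TracialState M) (x : M) : ℝ :=
  Real.sqrt (τ (star x * x)).re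

/-- The Hilbert space tensor product. -/
abbrev HilbertTensor (H : Type u) [NormedAddCommGroup H] [InnerProductSpace ℂ H]
    (K : Type v) [NormedAddCommGroup K] [InnerProductSpace ℂ K] : Type (max u v) :=
  UniformSpace.Completion (H ⊗[ℂ] K)

/-- The bounded operator `x ⊗ b` on the Hilbert space tensor product. -/
def opTensor (x : H →L[ℂ] H) (b : K →L[ℂ] K) : HilbertTensor H K →L[ℂ] HilbertTensor H K :=
  (TensorProduct.mapL x b).completion

/-- The von Neumann algebra generated by a set of operators: the double commutant of the
star-closure of the set. -/
def generatedBy (S : Set (H →L[ℂ] H)) : VonNeumannAlgebra H where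
  toStarSubalgebra :=
    StarSubalgebra.centralizer ℂ (StarSubalgebra.centralizer ℂ S : Set (H →L[ℂ] H))
  centralizer_centralizer' := by
    simp

/-- `ℓ²` indexed by `ℤ`. -/
abbrev L2Z : Type := lp (fun _ : ℤ => ℂ) 2

/-- The standard basis vector `e_i` of `ℓ²(ℤ)`. -/
def basisVec (i : ℤ) : L2Z := lp.single 2 i (1 : ℂ)

/-- The von Neumann algebra `M_∞`, the von Neumann algebra tensor product of `M` with the algebra
of all bounded operators on `ℓ²(ℤ)`. -/
def amplification (M : VonNeumannAlgebra H) : VonNeumannAlgebra (HilbertTensor H L2Z) :=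
  generatedBy {X | ∃ x ∈ M, ∃ b : L2Z →L[ℂ] L2Z, X = opTensor x b}

/-- The isometry `h ↦ h ⊗ e_i`. -/
def colVec (i : ℤ) : H →L[ℂ] HilbertTensor H L2Z :=
  UniformSpace.Completion.toComplL ∘L ((TensorProduct.mkL ℂ H L2Z).flip (basisVec i))

/-- The matrix entry `e_i* X e_j`, an operator on `H`. -/
def entryOp (i j : ℤ) (X : HilbertTensor H L2Z →L[ℂ] HilbertTensor H L2Z) : H →L[ℂ] H :=
  (colVec i).adjoint ∘L X ∘L colVec j

lemma opTensor_colVec (x : H →L[ℂ] H) (b : L2Z →L[ℂ] L2Z) (j : ℤ) (h : H) :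
    opTensor x b (colVec j h) =
      ((x h ⊗ₜ[ℂ] b (basisVec j) : H ⊗[ℂ] L2Z) : HilbertTensor H L2Z) := by
  have : colVec j h = ((h ⊗ₜ[ℂ] basisVec j : H ⊗[ℂ] L2Z) : HilbertTensor H L2Z) := rfl
  rw [this, opTensor, ContinuousLinearMap.completion_apply_coe, TensorProduct.mapL_tmul]

lemma opTensor_ext {A B : HilbertTensor H K →L[ℂ] HilbertTensor H K}
    (h : ∀ (x : H) (y : K), A ((x ⊗ₜ[ℂ] y : H ⊗[ℂ] K) : HilbertTensor H K) =
      B ((x ⊗ₜ[ℂ] y : H ⊗[ℂ] K) : HilbertTensor H K)) : A = B := by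
  ext z
  induction z using UniformSpace.Completion.induction_on with
  | hp => exact isClosed_eq A.continuous B.continuous
  | ih z =>
    induction z using TensorProduct.induction_on with
    | zero => rw [UniformSpace.Completion.coe_zero, map_zero, map_zero]
    | tmul x y => exact h x y
    | add x y hx hy => rw [UniformSpace.Completion.coe_add, map_add, map_add, hx, hy]

lemma opTensor_tmul (x : H →L[ℂ] H) (b : K →L[ℂ] K) (h : H) (k : K) :
    opTensor x b ((h ⊗ₜ[ℂ] k : H ⊗[ℂ] K) : HilbertTensor H K) =
      ((x h ⊗ₜ[ℂ] b k : H ⊗[ℂ] K) : HilbertTensor H K) := by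
  rw [opTensor, ContinuousLinearMap.completion_apply_coe, TensorProduct.mapL_tmul]

lemma opTensor_mul (x y : H →L[ℂ] H) (b c : K →L[ℂ] K) :
    opTensor x b * opTensor y c = opTensor (x * y) (b * c) := by
  apply opTensor_ext
  intro h k
  simp [opTensor_tmul]

lemma opTensor_star (x : H →L[ℂ] H) (b : K →L[ℂ] K) :
    star (opTensor x b) = opTensor (star x) (star b) := by
  symm
  rw [ContinuousLinearMap.star_eq_adjoint (opTensor x b), ContinuousLinearMap.eq_adjoint_iff]
  intro z w
  induction z, w using UniformSpace.Completion.induction_on₂ with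
  | hp => exact isClosed_eq (by fun_prop) (by fun_prop)
  | ih z w =>
    induction z using TensorProduct.induction_on with
    | zero =>
      rw [UniformSpace.Completion.coe_zero, map_zero, inner_zero_left, inner_zero_left]
    | add a b ha hb =>
      rw [UniformSpace.Completion.coe_add, map_add, inner_add_left, inner_add_left, ha, hb]
    | tmul h k =>
      induction w using TensorProduct.induction_on with
      | zero =>
        rw [UniformSpace.Completion.coe_zero, map_zero, inner_zero_right, inner_zero_right]
      | add a b ha hb =>
        rw [UniformSpace.Completion.coe_add, map_add, inner_add_right, inner_add_right, ha, hb]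
      | tmul h' k' =>
        simp only [opTensor_tmul, UniformSpace.Completion.inner_coe, TensorProduct.inner_tmul,
          ContinuousLinearMap.star_eq_adjoint, ContinuousLinearMap.adjoint_inner_left]

lemma opTensor_mem (M : VonNeumannAlgebra H) {x : H →L[ℂ] H} (hx : x ∈ M)
    (b : L2Z →L[ℂ] L2Z) : opTensor x b ∈ amplification M := by
  change _ ∈ StarSubalgebra.centralizer ℂ _
  rw [StarSubalgebra.mem_centralizer_iff]
  intro g hg
  have hg' := hg
  rw [SetLike.mem_coe, StarSubalgebra.mem_centralizer_iff] at hg hg'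
  have h1 := (hg _ ⟨x, hx, b, rfl⟩)
  refine ⟨h1.1.symm, ?_⟩
  have := congrArg star h1.2
  simpa using this

lemma commute_of_mem_amplification (M : VonNeumannAlgebra H)
    {X : HilbertTensor H L2Z →L[ℂ] HilbertTensor H L2Z} (hX : X ∈ amplification M)
    {y : H →L[ℂ] H} (hy : y ∈ M.commutant) : opTensor y 1 * X = X * opTensor y 1 := by
  change _ ∈ StarSubalgebra.centralizer ℂ _ at hX
  rw [StarSubalgebra.mem_centralizer_iff] at hX
  refine (hX _ ?_).1
  rw [SetLike.mem_coe, StarSubalgebra.mem_centralizer_iff]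
  rintro _ ⟨x, hx, b, rfl⟩
  rw [VonNeumannAlgebra.mem_commutant_iff] at hy
  rw [opTensor_star, opTensor_mul, opTensor_mul, opTensor_mul, opTensor_mul, hy x hx,
    hy (star x) (star_mem hx)]
  simp

lemma colVec_comp (y : H →L[ℂ] H) (j : ℤ) :
    (opTensor y 1) ∘L (colVec j : H →L[ℂ] HilbertTensor H L2Z) = colVec j ∘L y := by
  ext1 h
  change opTensor y 1 (colVec j h) = _
  rw [opTensor_colVec]
  rfl

/-- The matrix entries of an element of `M_∞` lie in `M`. -/
lemma entryOp_mem (M : VonNeumannAlgebra H) (i j : ℤ)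
    {X : HilbertTensor H L2Z →L[ℂ] HilbertTensor H L2Z} (hX : X ∈ amplification M) :
    entryOp i j X ∈ M := by
  rw [← VonNeumannAlgebra.commutant_commutant M, VonNeumannAlgebra.mem_commutant_iff]
  intro y hy
  have h1 := commute_of_mem_amplification M hX hy
  have h2 := colVec_comp y j
  have h3 : y ∘L (colVec i : H →L[ℂ] HilbertTensor H L2Z).adjoint =
      (colVec i).adjoint ∘L opTensor y 1 := by
    have := congrArg ContinuousLinearMap.adjoint (colVec_comp (star y) i)
    rw [ContinuousLinearMap.adjoint_comp, ContinuousLinearMap.adjoint_comp,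
      ← ContinuousLinearMap.star_eq_adjoint (opTensor _ _), opTensor_star,
      ← ContinuousLinearMap.star_eq_adjoint (star y), star_star, star_one] at this
    exact this.symm
  calc y ∘L ((colVec i).adjoint ∘L X ∘L colVec j)
      = (y ∘L (colVec i).adjoint) ∘L X ∘L colVec j := rfl
    _ = (colVec i).adjoint ∘L (opTensor y 1 * X) ∘L colVec j := by rw [h3]; rfl
    _ = (colVec i).adjoint ∘L X ∘L (opTensor y 1 ∘L colVec j) := by rw [h1]; rfl
    _ = ((colVec i).adjoint ∘L X ∘L colVec j) ∘L y := by rw [h2]; rfl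

/-- The matrix entry `e_i* X e_j` of `X ∈ M_∞`, as an element of `M`. -/
def entry {M : VonNeumannAlgebra H} (i j : ℤ) (X : amplification M) : M :=
  ⟨entryOp i j X, entryOp_mem M i j X.2⟩

/-- The trace `τ_∞ = τ ⊗ Tr` on the positive elements of `M_∞`, with values in `[0, ∞]`:
`τ_∞(X) = ∑_i τ(e_i* X e_i)`. It is used at positive elements only. -/
def TracialState.traceInf {M : VonNeumannAlgebra H} (τ : TracialState M)
    (X : amplification M) : ℝ≥0∞ :=
  ∑' i : ℤ, ENNReal.ofReal (τ (entry i i X)).re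

/-- The embedding `x ↦ x ⊗ Id₁` of `M` as a corner of `M_∞`, where `Id₁` is the projection
onto the line spanned by `e_1`. -/
def cornerEmb {M : VonNeumannAlgebra H} (x : M) : amplification M :=
  ⟨opTensor x (InnerProductSpace.rankOne ℂ (basisVec 1) (basisVec 1)), opTensor_mem M x.2 _⟩

/-- The unit `I_M` of the corner `M ⊗ Id₁` of `M_∞`. -/
def cornerUnit (M : VonNeumannAlgebra H) : amplification M := cornerEmb 1

/-- The identification of the corner `I_M M_∞ I_M` with `M`: the inverse of `cornerEmb`. -/
def toBase {M : VonNeumannAlgebra H} (X : amplification M) : M := entry 1 1 X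

lemma inner_basisVec_self (i : ℤ) : ⟪basisVec i, basisVec i⟫_ℂ = 1 := by
  rw [basisVec, lp.inner_single_left, lp.single_apply_self]
  simp

lemma colVec_adjoint_tmul (i : ℤ) (h : H) (v : L2Z) :
    (colVec i : H →L[ℂ] HilbertTensor H L2Z).adjoint
      ((h ⊗ₜ[ℂ] v : H ⊗[ℂ] L2Z) : HilbertTensor H L2Z) = ⟪basisVec i, v⟫_ℂ • h := by
  refine ext_inner_left ℂ fun g => ?_
  rw [ContinuousLinearMap.adjoint_inner_right]
  change inner ℂ ((g ⊗ₜ[ℂ] basisVec i : H ⊗[ℂ] L2Z) : HilbertTensor H L2Z) _ = _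
  rw [UniformSpace.Completion.inner_coe, TensorProduct.inner_tmul, inner_smul_right, mul_comm]

lemma toBase_cornerEmb {M : VonNeumannAlgebra H} (x : M) : toBase (cornerEmb x) = x := by
  apply Subtype.ext
  ext1 h
  change (colVec 1).adjoint (opTensor (x : H →L[ℂ] H) _ (colVec 1 h)) = _
  rw [opTensor_colVec, colVec_adjoint_tmul, InnerProductSpace.rankOne_apply, inner_smul_right,
    inner_basisVec_self, one_mul, one_smul]

lemma cornerEmb_toBase {M : VonNeumannAlgebra H} (X : amplification M) :
    cornerEmb (toBase X) = cornerUnit M * X * cornerUnit M := by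
  have key : opTensor (1 : H →L[ℂ] H) (InnerProductSpace.rankOne ℂ (basisVec 1) (basisVec 1))
      = colVec 1 ∘L (colVec 1).adjoint := by
    apply opTensor_ext
    intro h v
    rw [opTensor_tmul]
    change _ = colVec 1 ((colVec 1).adjoint _)
    rw [colVec_adjoint_tmul, map_smul, InnerProductSpace.rankOne_apply, TensorProduct.tmul_smul,
      UniformSpace.Completion.coe_smul]
    rfl
  apply Subtype.ext
  change opTensor (entryOp 1 1 (X : HilbertTensor H L2Z →L[ℂ] HilbertTensor H L2Z)) _ =
    (opTensor (1 : H →L[ℂ] H) _ * (X : HilbertTensor H L2Z →L[ℂ] HilbertTensor H L2Z)) * opTensor (1 : H →L[ℂ] H) _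
  rw [key]
  apply opTensor_ext
  intro h v
  rw [opTensor_tmul, InnerProductSpace.rankOne_apply]
  change _ = colVec 1 ((colVec 1).adjoint ((X : HilbertTensor H L2Z →L[ℂ] HilbertTensor H L2Z)
    (colVec 1 ((colVec 1).adjoint _))))
  rw [colVec_adjoint_tmul, map_smul, map_smul, map_smul, map_smul, TensorProduct.tmul_smul,
    UniformSpace.Completion.coe_smul]
  rfl

/-- The set `P R Q = {P Y Q : Y ∈ R}`. -/
def compressSet {R : Type*} [Mul R] (P Q : R) : Set R := {X | ∃ Y, X = P * Y * Q}

/-- A partial isometry. -/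
def IsPartialIsometry {R : Type*} [Mul R] [Star R] (w : R) : Prop := w * star w * w = w

/-- A projective measurement with outcome set `A` on the corner `e R e`: a family of projections
in `e R e` which sums to its unit `e`. For `e = 1` it is a projective measurement on `R`. -/
structure IsProjectiveMeasurement {R : Type*} [Ring R] [Star R] {A : Type*} [Fintype A]
    (e : R) (T : A → R) : Prop where
  mem : ∀ a, T a ∈ compressSet e e
  proj : ∀ a, IsStarProjection (T a)
  sum_eq : ∑ a, T a = e

end

end TracialVN

namespace TracialVN

noncomputable section

universe u

set_option linter.unusedSectionVars false

variable {H : Type u} [NormedAddCommGroup H] [InnerProductSpace ℂ H] [CompleteSpace H]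

/-! ### Orthogonal decomposition of the tensor product into the columns `H ⊗ e_i`. -/

section Columns

/-! The operators `w* T_a w` would be orthogonal projections if `ww*` commuted with every `T_a`. The
proof replaces `ww*` by a projection `R ≤ P` that does commute with them and is Murray–von Neumann
equivalent to `w*w`. Such an `R` is built by an exchange argument
(`exists_isStarProjection_complement_ker`): going through the outcomes, one takes from the range of
each `T_a` a piece on which `w*` stays injective, until no nonzero vector of the range of `w` is
orthogonal to `R`. Then `w*R` has kernel `ker R`, its adjoint `Rw` has kernel `ker w`, and the polar
part `u` of `w*R` satisfies `u*u = R` and `uu* = w*w`. Hence the `u T_a u*` are projections with sum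
`p = w*w`.

Closeness comes from the trace (`traceInf_star_mul_self`, where normality of `τ` enters): `R` and
`ww*` have the same finite trace, so `P - R` and `P - ww*` have the same trace `d`. With `|w*R|² ≤
|w*R|` this gives `‖u - w*‖² ≤ 4d` in Hilbert–Schmidt norm, and then `∑ ‖u T_a u* - w* T_a w‖² ≤
16d`, independently of the number of outcomes.

To reach sum `I_M`, the projection `I_M - p` is added to one outcome. It is orthogonal to everything
else and costs exactly its trace, at most `ε`. Finally `d ≤ ε τ_∞(P)` and `τ_∞(P) ≤ 1 + d`: for `ε <
1/2` this forces `τ_∞(P) ≤ 2` and a total of at most `33ε`, while for larger `ε` the crude bound `4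
+ ε` suffices. -/

lemma inner_basisVec_of_ne {i j : ℤ} (h : i ≠ j) : ⟪basisVec i, basisVec j⟫_ℂ = 0 := by
  rw [basisVec, lp.inner_single_left, basisVec, lp.single_apply_ne _ _ _ h]
  simp

lemma colVec_apply (i : ℤ) (h : H) :
    colVec i h = ((h ⊗ₜ[ℂ] basisVec i : H ⊗[ℂ] L2Z) : HilbertTensor H L2Z) := rfl

lemma colVec_adjoint_colVec_self (i : ℤ) (h : H) :
    (colVec i : H →L[ℂ] HilbertTensor H L2Z).adjoint (colVec i h) = h := by
  rw [colVec_apply, colVec_adjoint_tmul, inner_basisVec_self, one_smul]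

lemma colVec_adjoint_colVec_of_ne {i j : ℤ} (hij : i ≠ j) (h : H) :
    (colVec i : H →L[ℂ] HilbertTensor H L2Z).adjoint (colVec j h) = 0 := by
  rw [colVec_apply, colVec_adjoint_tmul, inner_basisVec_of_ne hij, zero_smul]

/-- The map `h ↦ h ⊗ e_i` as a linear isometry. -/
def colIsometry (i : ℤ) : H →ₗᵢ[ℂ] HilbertTensor H L2Z where
  toLinearMap := (colVec i : H →L[ℂ] HilbertTensor H L2Z).toLinearMap
  norm_map' h := by
    have : ⟪colVec i h, colVec i h⟫_ℂ = ⟪h, h⟫_ℂ := by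
      rw [← ContinuousLinearMap.adjoint_inner_right, colVec_adjoint_colVec_self]
    change ‖colVec i h‖ = ‖h‖
    rw [@norm_eq_sqrt_re_inner ℂ, this, ← @norm_eq_sqrt_re_inner ℂ]

lemma colIsometry_apply (i : ℤ) (h : H) : colIsometry i h = colVec i h := rfl

/-- For fixed `h`, the adjoint of `v ↦ h ⊗ v` sends `z` to a sequence in `ℓ²(ℤ)` whose coordinates
are `⟪h ⊗ e_i, z⟫`. Thus `z` is orthogonal to all elementary tensors, which span a dense subspace.
-/
lemma eq_zero_of_colVec_adjoint_eq_zero (z : HilbertTensor H L2Z)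
    (hz : ∀ i, (colVec i : H →L[ℂ] HilbertTensor H L2Z).adjoint z = 0) : z = 0 := by
  have key : ∀ (h : H) (v : L2Z),
      ⟪((h ⊗ₜ[ℂ] v : H ⊗[ℂ] L2Z) : HilbertTensor H L2Z), z⟫_ℂ = 0 := by
    intro h v
    let L : L2Z →L[ℂ] HilbertTensor H L2Z :=
      UniformSpace.Completion.toComplL ∘L (TensorProduct.mkL ℂ H L2Z h)
    have hL : L.adjoint z = 0 := by
      ext i
      have h1 : ⟪basisVec i, L.adjoint z⟫_ℂ = 0 := by
        rw [ContinuousLinearMap.adjoint_inner_right]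
        change ⟪colVec i h, z⟫_ℂ = 0
        rw [← ContinuousLinearMap.adjoint_inner_right, hz, inner_zero_right]
      rw [basisVec, lp.inner_single_left] at h1
      simpa using h1
    change ⟪L v, z⟫_ℂ = 0
    rw [← ContinuousLinearMap.adjoint_inner_right, hL, inner_zero_right]
  have key2 : ∀ y : HilbertTensor H L2Z, ⟪y, z⟫_ℂ = 0 := by
    intro y
    induction y using UniformSpace.Completion.induction_on with
    | hp => exact isClosed_eq (by fun_prop) (by fun_prop)
    | ih y =>
      induction y using TensorProduct.induction_on with
      | zero => rw [UniformSpace.Completion.coe_zero, inner_zero_left]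
      | tmul h v => exact key h v
      | add a b ha hb => rw [UniformSpace.Completion.coe_add, inner_add_left, ha, hb, add_zero]
  exact inner_self_eq_zero.1 (key2 z)

lemma isHilbertSum_colIsometry :
    IsHilbertSum ℂ (fun _ : ℤ => H) (fun i => (colIsometry i : H →ₗᵢ[ℂ] HilbertTensor H L2Z)) := by
  refine IsHilbertSum.mk ?_ ?_
  · intro i j hij v w
    change ⟪colVec i v, colVec j w⟫_ℂ = 0
    rw [← ContinuousLinearMap.adjoint_inner_right, colVec_adjoint_colVec_of_ne hij,
      inner_zero_right]
  · rw [top_le_iff, Submodule.topologicalClosure_eq_top_iff, eq_bot_iff]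
    intro z hz
    rw [Submodule.mem_bot]
    refine eq_zero_of_colVec_adjoint_eq_zero z fun i => ?_
    refine ext_inner_left ℂ fun h => ?_
    rw [ContinuousLinearMap.adjoint_inner_right, inner_zero_right]
    exact hz _ (Submodule.mem_iSup_of_mem i ⟨h, rfl⟩)

lemma hasSum_colVec (z : HilbertTensor H L2Z) :
    HasSum (fun j => colVec j ((colVec j : H →L[ℂ] HilbertTensor H L2Z).adjoint z)) z := by
  have hV := isHilbertSum_colIsometry (H := H)
  set f := hV.linearIsometryEquiv z with hf
  have h1 := hV.hasSum_linearIsometryEquiv_symm f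
  rw [hf, LinearIsometryEquiv.symm_apply_apply] at h1
  convert h1 using 2 with j
  rw [colIsometry_apply]
  congr 1
  have h2 := h1.mapL (colVec j : H →L[ℂ] HilbertTensor H L2Z).adjoint
  refine h2.unique ?_
  convert hasSum_single j ?_ using 1
  · rw [colIsometry_apply, colVec_adjoint_colVec_self]
  · intro i hi
    rw [colIsometry_apply, colVec_adjoint_colVec_of_ne hi.symm]

lemma hasSum_inner_colVec_adjoint (z : HilbertTensor H L2Z) :
    HasSum (fun j => ⟪(colVec j : H →L[ℂ] HilbertTensor H L2Z).adjoint z,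
      (colVec j : H →L[ℂ] HilbertTensor H L2Z).adjoint z⟫_ℂ) ⟪z, z⟫_ℂ := by
  have h := (hasSum_colVec z).mapL (innerSL ℂ z)
  simp only [innerSL_apply_apply] at h
  refine h.congr_fun ?_
  intro j
  rw [ContinuousLinearMap.adjoint_inner_left]

end Columns

/-! ### Matrix entries of elements of `M_∞`, and their order properties. -/

section Entries

variable {M : VonNeumannAlgebra H}

lemma coe_entry_apply (i j : ℤ) (X : amplification M) (h : H) :
    (entry i j X : H →L[ℂ] H) h = (colVec i).adjoint
      ((X : HilbertTensor H L2Z →L[ℂ] HilbertTensor H L2Z) (colVec j h)) := rfl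

lemma entry_star (i j : ℤ) (X : amplification M) : entry i j (star X) = star (entry j i X) := by
  apply Subtype.ext
  change (colVec i).adjoint ∘L (star (X : HilbertTensor H L2Z →L[ℂ] HilbertTensor H L2Z)) ∘L
    colVec j = star ((colVec j).adjoint ∘L (X : HilbertTensor H L2Z →L[ℂ] HilbertTensor H L2Z) ∘L
      colVec i)
  rw [ContinuousLinearMap.star_eq_adjoint, ContinuousLinearMap.star_eq_adjoint,
    ContinuousLinearMap.adjoint_comp, ContinuousLinearMap.adjoint_comp,
    ContinuousLinearMap.adjoint_adjoint, ContinuousLinearMap.comp_assoc]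

lemma entry_add (i j : ℤ) (X Y : amplification M) :
    entry i j (X + Y) = entry i j X + entry i j Y := by
  apply Subtype.ext
  ext1 h
  change (colVec i).adjoint (_ + _) = _
  rw [map_add]
  rfl

/-- The order on `ℂ` forces the difference of the two sides to be real, which on a complex space
makes `B - A` self-adjoint. -/
lemma le_iff_inner_le {A B : H →L[ℂ] H} : A ≤ B ↔ ∀ h, ⟪h, A h⟫_ℂ ≤ ⟪h, B h⟫_ℂ := by
  rw [ContinuousLinearMap.le_def]
  constructor
  · intro hAB h
    have := hAB.inner_nonneg_right h
    rwa [sub_apply, inner_sub_right, sub_nonneg] at this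
  · intro hAB
    rw [ContinuousLinearMap.isPositive_iff_complex]
    intro h
    have h1 : 0 ≤ ⟪h, (B - A) h⟫_ℂ := by
      rw [sub_apply, inner_sub_right, sub_nonneg]
      exact hAB h
    have h2 : 0 ≤ ⟪(B - A) h, h⟫_ℂ := by
      rw [← inner_conj_symm]
      exact star_nonneg_iff.2 h1
    rw [Complex.le_def] at h2
    exact ⟨Complex.ext (Complex.ofReal_re _) ((Complex.ofReal_im _).trans h2.2), h2.1⟩

lemma inner_entry_self (i : ℤ) (X : amplification M) (h : H) :
    ⟪h, (entry i i X : H →L[ℂ] H) h⟫_ℂ = ⟪colVec i h,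
      (X : HilbertTensor H L2Z →L[ℂ] HilbertTensor H L2Z) (colVec i h)⟫_ℂ := by
  rw [coe_entry_apply, ContinuousLinearMap.adjoint_inner_right]

lemma entry_mono (i : ℤ) {X Y : amplification M} (h : X ≤ Y) : entry i i X ≤ entry i i Y := by
  rw [← Subtype.coe_le_coe, le_iff_inner_le] at h ⊢
  intro v
  rw [inner_entry_self, inner_entry_self]
  exact h _

/-- Parseval for `Y (h ⊗ e_i)` along the columns, read as an increasing supremum of positive
elements. This is the form in which normality of `τ` applies. -/
lemma isLUB_entry_star_mul_self (i : ℤ) (Y : amplification M) :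
    IsLUB (Set.range fun F : Finset ℤ => ∑ j ∈ F, star (entry j i Y) * entry j i Y)
      (entry i i (star Y * Y)) := by
  have hs : ∀ h : H, HasSum (fun j => ⟪h, ((star (entry j i Y) * entry j i Y : M) :
      H →L[ℂ] H) h⟫_ℂ) ⟪h, (entry i i (star Y * Y) : H →L[ℂ] H) h⟫_ℂ := by
    intro h
    have h1 := hasSum_inner_colVec_adjoint
      ((Y : HilbertTensor H L2Z →L[ℂ] HilbertTensor H L2Z) (colVec i h))
    convert h1 using 1
    · ext j
      change ⟪h, (star (entry j i Y : H →L[ℂ] H)) ((entry j i Y : H →L[ℂ] H) h)⟫_ℂ = _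
      rw [ContinuousLinearMap.star_eq_adjoint, ContinuousLinearMap.adjoint_inner_right]
      rfl
    · rw [inner_entry_self]
      change ⟪_, (star (Y : HilbertTensor H L2Z →L[ℂ] HilbertTensor H L2Z)) _⟫_ℂ = _
      rw [ContinuousLinearMap.star_eq_adjoint, ContinuousLinearMap.adjoint_inner_right]
      rfl
  have hsum : ∀ (F : Finset ℤ) (h : H),
      ⟪h, ((∑ j ∈ F, star (entry j i Y) * entry j i Y : M) : H →L[ℂ] H) h⟫_ℂ =
      ∑ j ∈ F, ⟪h, ((star (entry j i Y) * entry j i Y : M) : H →L[ℂ] H) h⟫_ℂ := by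
    intro F h
    rw [AddSubmonoidClass.coe_finsetSum, sum_apply, inner_sum]
  have hpos : ∀ (j : ℤ) (h : H),
      0 ≤ ⟪h, ((star (entry j i Y) * entry j i Y : M) : H →L[ℂ] H) h⟫_ℂ := by
    intro j h
    have : (0 : H →L[ℂ] H) ≤ star (entry j i Y : H →L[ℂ] H) * entry j i Y :=
      star_mul_self_nonneg _
    exact (ContinuousLinearMap.nonneg_iff_isPositive _).1 this |>.inner_nonneg_right h
  constructor
  · rintro _ ⟨F, rfl⟩
    rw [← Subtype.coe_le_coe, le_iff_inner_le]
    intro h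
    rw [hsum]
    exact sum_le_hasSum F (fun j _ => hpos j h) (hs h)
  · intro B hB
    rw [← Subtype.coe_le_coe, le_iff_inner_le]
    intro h
    refine hasSum_le_of_sum_le (hs h) fun F => ?_
    rw [← hsum]
    exact le_iff_inner_le.1 (Subtype.coe_le_coe.2 (hB ⟨F, rfl⟩)) h

end Entries

/-! ### The trace on `M_∞`: monotonicity, additivity, traciality. -/

section Trace

variable {M : VonNeumannAlgebra H}

lemma sqrt_mem (N : VonNeumannAlgebra H) {x : H →L[ℂ] H} (hx : x ∈ N) : CFC.sqrt x ∈ N := by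
  rw [← VonNeumannAlgebra.commutant_commutant N, VonNeumannAlgebra.mem_commutant_iff]
  intro y hy
  have h : Commute x y := VonNeumannAlgebra.mem_commutant_iff.1 hy x hx
  exact (h.cfcₙ_nnreal _).symm

lemma exists_star_mul_self_eq {x : M} (hx : 0 ≤ x) : ∃ y : M, star y * y = x := by
  have hx' : (0 : H →L[ℂ] H) ≤ x := hx
  refine ⟨⟨CFC.sqrt (x : H →L[ℂ] H), sqrt_mem M x.2⟩, Subtype.ext ?_⟩
  change star (CFC.sqrt (x : H →L[ℂ] H)) * CFC.sqrt (x : H →L[ℂ] H) = x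
  rw [(CFC.sqrt_nonneg (x : H →L[ℂ] H)).isSelfAdjoint.star_eq, CFC.sqrt_mul_sqrt_self _ hx']

lemma star_mul_self_nonneg_subtype (x : M) : 0 ≤ star x * x :=
  star_mul_self_nonneg (x : H →L[ℂ] H)

lemma sub_nonneg_subtype {x y : M} : 0 ≤ y - x ↔ x ≤ y :=
  sub_nonneg (a := (y : H →L[ℂ] H)) (b := x)

lemma conj_le_conj_subtype {x y : M} (h : x ≤ y) (z : M) : star z * x * z ≤ star z * y * z :=
  star_left_conjugate_le_conjugate (a := (x : H →L[ℂ] H)) (b := y) h z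

lemma add_le_add_subtype {x y x' y' : M} (h : x ≤ y) (h' : x' ≤ y') : x + x' ≤ y + y' :=
  add_le_add (a := (x : H →L[ℂ] H)) (b := y) h h'

namespace TracialState

variable (τ : TracialState M)

lemma re_nonneg {x : M} (hx : 0 ≤ x) : 0 ≤ (τ x).re := by
  obtain ⟨y, rfl⟩ := exists_star_mul_self_eq hx
  exact (Complex.le_def.1 (τ.nonneg' y)).1

lemma re_mono {x y : M} (h : x ≤ y) : (τ x).re ≤ (τ y).re := by
  have := τ.re_nonneg (sub_nonneg_subtype.2 h)
  rwa [map_sub, Complex.sub_re, sub_nonneg] at this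

lemma traceInf_mono {X Y : amplification M} (h : X ≤ Y) : τ.traceInf X ≤ τ.traceInf Y :=
  ENNReal.tsum_le_tsum fun i => ENNReal.ofReal_le_ofReal (τ.re_mono (entry_mono i h))

lemma entry_zero (i j : ℤ) : entry i j (0 : amplification M) = 0 := by
  have := entry_add i j (0 : amplification M) 0
  rwa [add_zero, left_eq_add] at this

lemma entry_nonneg (i : ℤ) {X : amplification M} (h : 0 ≤ X) : 0 ≤ entry i i X := by
  have := entry_mono i h
  rwa [entry_zero] at this

lemma traceInf_zero : τ.traceInf 0 = 0 := by
  simp [traceInf, entry_zero]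

/-- Positivity matters because `ENNReal.ofReal` truncates negative diagonal values to zero. -/
lemma traceInf_add {X Y : amplification M} (hX : 0 ≤ X) (hY : 0 ≤ Y) :
    τ.traceInf (X + Y) = τ.traceInf X + τ.traceInf Y := by
  rw [traceInf, traceInf, traceInf, ← ENNReal.tsum_add]
  refine tsum_congr fun i => ?_
  rw [entry_add, map_add, Complex.add_re, ENNReal.ofReal_add (τ.re_nonneg (entry_nonneg i hX))
    (τ.re_nonneg (entry_nonneg i hY))]

lemma ofReal_re_entry_star_mul_self (i : ℤ) (Y : amplification M) :
    ENNReal.ofReal (τ (entry i i (star Y * Y))).re =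
      ∑' j, ENNReal.ofReal (τ (star (entry j i Y) * entry j i Y)).re := by
  have hpos : ∀ j, 0 ≤ (τ (star (entry j i Y) * entry j i Y)).re :=
    fun j => τ.re_nonneg (star_mul_self_nonneg_subtype _)
  have hmono : Monotone fun F : Finset ℤ => ∑ j ∈ F, star (entry j i Y) * entry j i Y := by
    intro F G hFG
    rw [← Subtype.coe_le_coe, AddSubmonoidClass.coe_finsetSum, AddSubmonoidClass.coe_finsetSum]
    exact Finset.sum_le_sum_of_subset_of_nonneg hFG
      fun j _ _ => star_mul_self_nonneg_subtype (entry j i Y)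
  have h := τ.normal' _ _ (Set.range_nonempty _) hmono.directed_le.directedOn_range ?_
    (isLUB_entry_star_mul_self i Y)
  · have hs : HasSum (fun j => (τ (star (entry j i Y) * entry j i Y)).re)
        (τ (entry i i (star Y * Y))).re := by
      refine hasSum_of_isLUB_of_nonneg _ hpos ?_
      rw [← Set.range_comp] at h
      have h2 : ∀ F : Finset ℤ, (τ (∑ j ∈ F, star (entry j i Y) * entry j i Y)).re =
          ∑ j ∈ F, (τ (star (entry j i Y) * entry j i Y)).re := fun F => by
        rw [map_sum, Complex.re_sum]
      rwa [← funext h2]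
    rw [← hs.tsum_eq, ENNReal.ofReal_tsum_of_nonneg hpos hs.summable]
  · rintro _ ⟨F, rfl⟩
    have h0 : 0 ≤ ∑ j ∈ F, star (entry j i Y) * entry j i Y := by
      simpa only [Finset.sum_empty] using hmono (Finset.empty_subset F)
    exact h0

/-- Both sides are double sums over the entries of `Y`. Nonnegative sums may be exchanged, and
traciality of `τ` matches them term by term. -/
lemma traceInf_star_mul_self (Y : amplification M) :
    τ.traceInf (star Y * Y) = τ.traceInf (Y * star Y) := by
  have h1 : τ.traceInf (star Y * Y) =
      ∑' i, ∑' j, ENNReal.ofReal (τ (star (entry j i Y) * entry j i Y)).re :=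
    tsum_congr fun i => τ.ofReal_re_entry_star_mul_self i Y
  have h2 : τ.traceInf (Y * star Y) =
      ∑' i, ∑' j, ENNReal.ofReal (τ (star (entry j i (star Y)) * entry j i (star Y))).re := by
    refine tsum_congr fun i => ?_
    rw [← τ.ofReal_re_entry_star_mul_self i (star Y), star_star]
  rw [h1, h2, ENNReal.tsum_comm]
  refine tsum_congr fun i => tsum_congr fun j => ?_
  rw [entry_star, star_star]
  exact congrArg (fun z : ℂ => ENNReal.ofReal z.re) (τ.tracial' _ _)

lemma traceInf_cornerEmb (x : M) : τ.traceInf (cornerEmb x) = ENNReal.ofReal (τ x).re := by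
  rw [traceInf, tsum_eq_single 1]
  · rw [← toBase, toBase_cornerEmb]
  · intro i hi
    have : entry i i (cornerEmb x) = 0 := by
      apply Subtype.ext
      ext1 h
      rw [coe_entry_apply]
      change (colVec i).adjoint (opTensor (x : H →L[ℂ] H) _ (colVec i h)) = 0
      rw [opTensor_colVec, InnerProductSpace.rankOne_apply, inner_basisVec_of_ne hi.symm,
        zero_smul, TensorProduct.tmul_zero, UniformSpace.Completion.coe_zero, map_zero]
    rw [this]
    simp

end TracialState

end Trace

/-! ### Polar decomposition inside a von Neumann algebra. -/

section Polar

lemma star_mul_self_eq_of_norm_eq {A B : H →L[ℂ] H} (h : ∀ x, ‖A x‖ = ‖B x‖) :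
    star A * A = star B * B := by
  have key : ∀ C : H →L[ℂ] H, ∀ x, ⟪(star C * C) x, x⟫_ℂ = (‖C x‖ ^ 2 : ℝ) := by
    intro C x
    change ⟪(star C) (C x), x⟫_ℂ = _
    rw [ContinuousLinearMap.star_eq_adjoint, ContinuousLinearMap.adjoint_inner_left,
      inner_self_eq_norm_sq_to_K]
    simp
  refine ContinuousLinearMap.coe_inj.1 ((ext_inner_map _ _).1 fun x => ?_)
  exact (key A x).trans ((h x ▸ rfl : _ = _).trans (key B x).symm)

/-- Since `p` kills the range of `1 - q`, one has `p = pq`, and symmetrically `q = qp`; taking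
adjoints identifies the two. -/
lemma isStarProjection_eq_of_ker_eq {p q : H →L[ℂ] H} (hp : IsStarProjection p)
    (hq : IsStarProjection q) (h : ∀ x, p x = 0 ↔ q x = 0) : p = q := by
  have key : ∀ {a b : H →L[ℂ] H}, IsStarProjection b → (∀ x, b x = 0 → a x = 0) → a = a * b := by
    intro a b hb hab
    ext x
    have h1 : b (x - b x) = 0 := by
      rw [map_sub, sub_eq_zero]
      exact (congrArg (· x) hb.isIdempotentElem.eq).symm
    have := hab _ h1
    rwa [map_sub, sub_eq_zero] at this
  have h1 := key hq (a := p) fun x => (h x).2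
  have h2 := key hp (a := q) fun x => (h x).1
  have h3 := congrArg star h1
  rw [star_mul, hp.isSelfAdjoint.star_eq, hq.isSelfAdjoint.star_eq, ← h2] at h3
  exact h3

lemma norm_abs_apply (x : H →L[ℂ] H) (z : H) : ‖CFC.abs x z‖ = ‖x z‖ := by
  have h : ∀ C : H →L[ℂ] H, ⟪C z, C z⟫_ℂ = ⟪(star C * C) z, z⟫_ℂ := by
    intro C
    change _ = ⟪(star C) (C z), z⟫_ℂ
    rw [ContinuousLinearMap.star_eq_adjoint, ContinuousLinearMap.adjoint_inner_left]
  have h1 : ⟪CFC.abs x z, CFC.abs x z⟫_ℂ = ⟪x z, x z⟫_ℂ := by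
    rw [h, h, (CFC.abs_nonneg x).isSelfAdjoint.star_eq, CFC.abs_mul_abs]
  rw [@norm_eq_sqrt_re_inner ℂ, h1, ← @norm_eq_sqrt_re_inner ℂ]

/-- The polar decomposition of an element of a von Neumann algebra. -/
theorem exists_polar (N : VonNeumannAlgebra H) {x : H →L[ℂ] H} (hx : x ∈ N) :
    ∃ u ∈ N, u * CFC.abs x = x ∧ star u * u * CFC.abs x = CFC.abs x ∧
      IsStarProjection (star u * u) ∧ IsStarProjection (u * star u) ∧
      (∀ z, (star u * u) z = 0 ↔ x z = 0) ∧ (∀ z, (u * star u) z = 0 ↔ star x z = 0) := by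
  set h := CFC.abs x with hh
  have hsa : star h = h := (CFC.abs_nonneg x).isSelfAdjoint.star_eq
  let F : Submodule ℂ H := h.range.topologicalClosure
  have : CompleteSpace F := h.range.isClosed_topologicalClosure.completeSpace_coe
  let e : H →ₗ[ℂ] F := h.toLinearMap.codRestrict F
    fun z => h.range.le_topologicalClosure ⟨z, rfl⟩
  have he : DenseRange e := by
    refine Subtype.dense_iff.2 fun z hz => ?_
    rw [← Set.range_comp]
    exact hz
  have hn : ∃ C, ∀ z, ‖x.toLinearMap z‖ ≤ C * ‖e z‖ := ⟨1, fun z => by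
    rw [one_mul]
    exact (norm_abs_apply x z).ge⟩
  -- The map `|x| z ↦ x z` is well defined and isometric because `‖|x| z‖ = ‖x z‖`; `g` is its
  -- extension to the closure of the range of `|x|`.
  let g : F →L[ℂ] H := x.toLinearMap.extendOfNorm e
  have hg : ∀ z, g (e z) = x z := LinearMap.extendOfNorm_eq he hn
  have hgn : ∀ y, ‖g y‖ = ‖y‖ := by
    intro y
    refine he.induction (P := fun y => ‖g y‖ = ‖y‖) ?_ (isClosed_eq (by fun_prop) (by fun_prop)) y
    rintro _ ⟨z, rfl⟩
    rw [hg]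
    exact (norm_abs_apply x z).symm
  let u : H →L[ℂ] H := g ∘L F.orthogonalProjectionOnto
  have huF : ∀ z, u (h z) = x z := by
    intro z
    rw [← hg]
    change g (F.orthogonalProjectionOnto (e z : H)) = _
    rw [Submodule.orthogonalProjectionOnto_mem_subspace_eq_self]
  have hu1 : u * h = x := ContinuousLinearMap.ext huF
  have hker : ∀ z, h z = 0 ↔ z ∈ Fᗮ := by
    intro z
    rw [Submodule.orthogonal_closure, ContinuousLinearMap.orthogonal_range,
      ← ContinuousLinearMap.star_eq_adjoint, hsa]
    rfl
  have huu : star u * u = F.starProjection := by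
    have h1 : star u * u = star F.starProjection * F.starProjection := by
      refine star_mul_self_eq_of_norm_eq fun z => ?_
      exact hgn _
    rw [h1, (isSelfAdjoint_starProjection F).star_eq,
      F.isIdempotentElem_starProjection.eq]
  have huuh : star u * u * h = h := by
    ext z
    rw [huu]
    exact Submodule.starProjection_eq_self_iff.2 (e z).2
  have hxu : star x = h * star u := by
    rw [← hu1, star_mul, hsa]
  have hxz : ∀ z, x z = 0 ↔ h z = 0 := fun z => by
    rw [← norm_eq_zero, ← norm_abs_apply, norm_eq_zero]
  have hfu : star u * u * star u = star u := by
    have h1 : u * (star u * u) = u := by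
      ext z
      rw [huu]
      change g (F.orthogonalProjectionOnto (F.orthogonalProjectionOnto z : H)) = _
      rw [Submodule.orthogonalProjectionOnto_mem_subspace_eq_self]
      rfl
    have h2 := congrArg star h1
    rwa [star_mul, star_mul, star_star] at h2
  refine ⟨u, ?_, hu1, huuh, ?_, ?_, ?_, ?_⟩
  · rw [← VonNeumannAlgebra.commutant_commutant N, VonNeumannAlgebra.mem_commutant_iff]
    intro y hy
    have hxy : Commute x y := VonNeumannAlgebra.mem_commutant_iff.1 hy x hx
    have hxy' : Commute x (star y) :=
      VonNeumannAlgebra.mem_commutant_iff.1 (star_mem hy) x hx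
    have hhy : Commute h y := hxy.cfcAbs_left hxy'
    -- Commutation of `u` with `y` is checked separately on `F` and on its orthogonal complement,
    -- both invariant under `y`.
    have h1 : F ≤ (y * u - u * y).ker := by
      refine Submodule.topologicalClosure_minimal _ ?_ (y * u - u * y).isClosed_ker
      rintro _ ⟨z, rfl⟩
      change y (u (h z)) - u (y (h z)) = 0
      have h2 : y (h z) = h (y z) := (congrArg (· z) hhy.eq).symm
      rw [h2, huF, huF, sub_eq_zero]
      exact (congrArg (· z) hxy.eq).symm
    have h3 : ∀ z ∈ Fᗮ, u z = 0 := by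
      intro z hz
      change g (F.orthogonalProjectionOnto z) = 0
      rw [Submodule.orthogonalProjectionOnto_eq_zero_iff.2 hz, map_zero]
    have h4 : Fᗮ ≤ (y * u - u * y).ker := by
      intro z hz
      change y (u z) - u (y z) = 0
      rw [h3 z hz, map_zero, h3 (y z), sub_zero]
      rw [← hker] at hz ⊢
      have h2 : h (y z) = y (h z) := congrArg (· z) hhy.eq
      rw [h2, hz, map_zero]
    rw [← sub_eq_zero]
    ext z
    have h5 : (y * u - u * y) (z - F.starProjection z) = 0 :=
      h4 (F.sub_starProjection_mem_orthogonal z)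
    have h6 : (y * u - u * y) (F.starProjection z) = 0 := h1 (F.starProjection_apply_mem z)
    rw [map_sub, h6, sub_zero] at h5
    exact h5
  · rw [huu]
    exact isStarProjection_starProjection
  · refine ⟨?_, IsSelfAdjoint.mul_star_self u⟩
    change _ * _ = _
    rw [mul_assoc, ← mul_assoc (star u), hfu]
  · intro z
    rw [huu, Submodule.starProjection_apply_eq_zero_iff, hxz, hker]
  · intro z
    rw [hxu]
    change u (star u z) = 0 ↔ h (star u z) = 0
    have h1 : (star u * u) (star u z) = star u z := congrArg (· z) hfu
    constructor
    · intro h2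
      change star u (u (star u z)) = star u z at h1
      rw [← h1, h2, map_zero, map_zero]
    · intro h2
      rw [hker, ← Submodule.starProjection_apply_eq_zero_iff, ← huu, h1] at h2
      rw [h2, map_zero]

end Polar

/-! ### The exchange argument producing a projection that commutes with the measurement. -/

section Exchange

/-- The submodule `U` is invariant under the commutant of `N`. -/
def IsAffiliated (N : VonNeumannAlgebra H) (U : Submodule ℂ H) : Prop :=
  ∀ y ∈ N.commutant, ∀ z ∈ U, y z ∈ U

lemma isAffiliated_ker {N : VonNeumannAlgebra H} {x : H →L[ℂ] H} (hx : x ∈ N) :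
    IsAffiliated N x.ker := by
  intro y hy z hz
  have h : x (y z) = y (x z) := congrArg (· z) (VonNeumannAlgebra.mem_commutant_iff.1 hy x hx)
  change x z = 0 at hz
  change x (y z) = 0
  rw [h, hz, map_zero]

lemma IsAffiliated.inf {N : VonNeumannAlgebra H} {U V : Submodule ℂ H} (hU : IsAffiliated N U)
    (hV : IsAffiliated N V) : IsAffiliated N (U ⊓ V) :=
  fun y hy z hz => ⟨hU y hy z hz.1, hV y hy z hz.2⟩

lemma IsAffiliated.orthogonal {N : VonNeumannAlgebra H} {U : Submodule ℂ H}
    (hU : IsAffiliated N U) : IsAffiliated N Uᗮ := by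
  intro y hy z hz w hw
  rw [← ContinuousLinearMap.adjoint_inner_left]
  exact hz _ (hU (star y) (star_mem hy) w hw)

lemma IsAffiliated.starProjection_mem {N : VonNeumannAlgebra H} {U : Submodule ℂ H}
    [U.HasOrthogonalProjection] (hU : IsAffiliated N U) : U.starProjection ∈ N := by
  rw [VonNeumannAlgebra.IsStarProjection.mem_iff isStarProjection_starProjection]
  intro y hy
  rw [Submodule.range_starProjection, Module.End.mem_invtSubmodule_iff_forall_mem_of_mem]
  exact hU y hy

/-- Exchange: given orthogonal projections `T a` and an operator `c`, there is a projection `R`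
below their sum, commuting with all of them, on whose range `c` is injective, and such that no
vector of the range of the sum is orthogonal to both `R` and the kernel of `c`. -/
theorem exists_isStarProjection_complement_ker (N : VonNeumannAlgebra H) {A : Type*}
    {T : A → H →L[ℂ] H} (hTN : ∀ a, T a ∈ N) (hT : ∀ a, IsStarProjection (T a))
    (hTT : ∀ a b, a ≠ b → T a * T b = 0) {c : H →L[ℂ] H} (hc : c ∈ N) (s : Finset A) :
    ∃ R ∈ N, IsStarProjection R ∧ (∀ a, T a * R = R * T a) ∧ (∑ a ∈ s, T a) * R = R ∧
      (∀ z, c (R z) = 0 → R z = 0) ∧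
      (∀ y ∈ c.kerᗮ, R y = 0 → ∀ a ∈ s, T a y = 0) := by
  classical
  induction s using Finset.induction_on with
  | empty =>
    exact ⟨0, zero_mem N, .zero _, by simp, by simp, by simp, by simp⟩
  | insert a s ha ih =>
    obtain ⟨R, hRN, hR, hTR, hsR, hcR, hyR⟩ := ih
    -- `E` holds the directions of `(ker c)ᗮ` not yet met by `R`. Inside the range `G` of `T a`, `W`
    -- is the part orthogonal to `E`, and `V`, its complement in `G`, is the closure of `T a E`.
    -- Only `V` is added to `R`.
    let E : Submodule ℂ H := c.kerᗮ ⊓ R.ker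
    let G : Submodule ℂ H := (1 - T a).ker
    have hG : ∀ z, z ∈ G ↔ T a z = z := fun z => by
      change z - T a z = 0 ↔ _
      rw [sub_eq_zero, eq_comm]
    have hTG : ∀ z, T a z ∈ G := fun z =>
      (hG _).2 (congrArg (· z) (hT a).isIdempotentElem.eq)
    have hGc : IsClosed (G : Set H) := (1 - T a).isClosed_ker
    let W : Submodule ℂ H := G ⊓ Eᗮ
    have : CompleteSpace W := (hGc.inter E.isClosed_orthogonal).completeSpace_coe
    let V : Submodule ℂ H := G ⊓ Wᗮ
    have : CompleteSpace V := (hGc.inter W.isClosed_orthogonal).completeSpace_coe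
    set r := V.starProjection with hr
    have hrp : IsStarProjection r := isStarProjection_starProjection
    have hGN : IsAffiliated N G := isAffiliated_ker (sub_mem (one_mem N) (hTN a))
    have hEN : IsAffiliated N E := (isAffiliated_ker hc).orthogonal.inf (isAffiliated_ker hRN)
    have hrN : r ∈ N := (hGN.inf (hGN.inf hEN.orthogonal).orthogonal).starProjection_mem
    have hTar : T a * r = r := by
      ext z
      exact (hG _).1 (V.starProjection_apply_mem z).1
    have hrT : r * T a = r := by
      have h1 := congrArg star hTar
      rwa [star_mul, hrp.isSelfAdjoint.star_eq, (hT a).isSelfAdjoint.star_eq] at h1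
    have hTaR : T a * R = 0 := by
      rw [← hsR, ← mul_assoc, Finset.mul_sum, Finset.sum_eq_zero, zero_mul]
      intro b hb
      exact hTT a b (by rintro rfl; exact ha hb)
    have hRTa : R * T a = 0 := by rw [← hTR, hTaR]
    have hrR : r * R = 0 := by rw [← hrT, mul_assoc, hTaR, mul_zero]
    have hRr : R * r = 0 := by rw [← hTar, ← mul_assoc, hRTa, zero_mul]
    refine ⟨R + r, add_mem hRN hrN, ⟨?_, hR.isSelfAdjoint.add hrp.isSelfAdjoint⟩, ?_, ?_, ?_, ?_⟩
    · change (R + r) * (R + r) = R + r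
      rw [add_mul, mul_add, mul_add, hR.isIdempotentElem.eq, hrp.isIdempotentElem.eq, hrR, hRr,
        add_zero, zero_add]
    · intro b
      rw [mul_add, add_mul, hTR b]
      congr 1
      by_cases hb : b = a
      · rw [hb, hTar, hrT]
      · rw [← hTar, ← mul_assoc, hTT b a hb, zero_mul, hTar, ← hrT, mul_assoc, hTT a b (Ne.symm hb),
          mul_zero]
    · rw [Finset.sum_insert ha, mul_add, add_mul, add_mul, hTaR, hsR, hTar, zero_add]
      rw [← hTar, ← mul_assoc, Finset.sum_mul, Finset.sum_eq_zero, zero_mul, add_zero]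
      intro b hb
      exact hTT b a (by rintro rfl; exact ha hb)
    · intro z hz
      have h1 : r z = 0 := by
        have hrz : r z ∈ V := V.starProjection_apply_mem z
        -- A vector of `E` is orthogonal to `R z + r z ∈ ker c` and to `R z`, hence to `r z`. So `r
        -- z` lies in `W` as well as in `V ≤ Wᗮ`, and vanishes.
        refine (inner_self_eq_zero (𝕜 := ℂ)).1 (hrz.2 _ ⟨hrz.1, fun w hw => ?_⟩)
        have h3 : ⟪w, R z⟫_ℂ = 0 := by
          have h4 : R w = 0 := hw.2
          rw [← hR.isSelfAdjoint.star_eq, ContinuousLinearMap.star_eq_adjoint,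
            ContinuousLinearMap.adjoint_inner_right, h4, inner_zero_left]
        have h5 : ⟪w, R z + r z⟫_ℂ = 0 := by
          have h6 : ⟪R z + r z, w⟫_ℂ = 0 := hw.1 _ hz
          rw [← inner_conj_symm, h6, map_zero]
        rwa [inner_add_right, h3, zero_add] at h5
      have h2 : (R + r) z = R z := by
        change R z + r z = _
        rw [h1, add_zero]
      rw [h2] at hz ⊢
      exact hcR z hz
    · intro y hy hRry
      have h1 : R y = 0 := by
        have := congrArg R hRry
        change R (R y + r y) = _ at this
        rw [map_zero, map_add] at this
        have h2 : R (R y) = R y := congrArg (· y) hR.isIdempotentElem.eq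
        have h3 : R (r y) = 0 := congrArg (· y) hRr
        rwa [h2, h3, add_zero] at this
      have h2 : r y = 0 := by
        change R y + r y = 0 at hRry
        rwa [h1, zero_add] at hRry
      intro b hb
      rcases Finset.mem_insert.1 hb with hb | hb
      · rw [hb]
        have hyV : y ∈ Vᗮ := V.starProjection_apply_eq_zero_iff.1 h2
        -- Here `y ∈ E ⊓ Vᗮ`. Splitting `T a y` along `W` and `V`, both parts are orthogonal to `y`,
        -- so `‖T a y‖² = ⟪T a y, y⟫ = 0`.
        have h3 : ⟪W.starProjection (T a y), y⟫_ℂ = 0 := by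
          rw [← inner_conj_symm, (W.starProjection_apply_mem (T a y)).2 y ⟨hy, h1⟩, map_zero]
        have h4 : ⟪T a y - W.starProjection (T a y), y⟫_ℂ = 0 :=
          hyV _ ⟨sub_mem (hTG y) (W.starProjection_apply_mem (T a y)).1,
            W.sub_starProjection_mem_orthogonal _⟩
        rw [inner_sub_left, h3, sub_zero] at h4
        refine (inner_self_eq_zero (𝕜 := ℂ)).1 ?_
        have h5 : T a (T a y) = T a y := (hG _).1 (hTG y)
        nth_rewrite 2 [← (hT a).isSelfAdjoint.star_eq]
        rw [ContinuousLinearMap.star_eq_adjoint, ContinuousLinearMap.adjoint_inner_right, h5, h4]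
      · exact hyR y hy h1 b hb

end Exchange

/-! ### Order and orthogonality of projections. -/

section Projections

lemma IsStarProjection.le_one' {M : VonNeumannAlgebra H} {p : M} (hp : IsStarProjection p) :
    p ≤ 1 := by
  rw [← sub_nonneg_subtype]
  have h := star_mul_self_nonneg_subtype (1 - p)
  rwa [hp.one_sub.isSelfAdjoint.star_eq, hp.one_sub.isIdempotentElem.eq] at h

lemma IsStarProjection.nonneg' {M : VonNeumannAlgebra H} {p : M} (hp : IsStarProjection p) :
    0 ≤ p := by
  have h := star_mul_self_nonneg_subtype p
  rwa [hp.isSelfAdjoint.star_eq, hp.isIdempotentElem.eq] at h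

lemma isStarProjection_sub_of_mul_eq {R : Type*} [Ring R] [StarRing R] {p q : R}
    (hp : IsStarProjection p) (hq : IsStarProjection q) (h : p * q = q) :
    IsStarProjection (p - q) := by
  have h' : q * p = q := by
    have := congrArg star h
    rwa [star_mul, hp.isSelfAdjoint.star_eq, hq.isSelfAdjoint.star_eq] at this
  refine ⟨?_, hp.isSelfAdjoint.sub hq.isSelfAdjoint⟩
  change (p - q) * (p - q) = p - q
  rw [sub_mul, mul_sub, mul_sub, hp.isIdempotentElem.eq, hq.isIdempotentElem.eq, h, h', sub_self,
    sub_zero]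

/-- Projections in a von Neumann algebra which sum to a projection are pairwise orthogonal. -/
lemma mul_eq_zero_of_sum_isStarProjection {N : VonNeumannAlgebra H} {A : Type*} [Fintype A]
    {P : N} {T : A → N} (hT : ∀ a, IsStarProjection (T a)) (hs : ∑ a, T a = P)
    (hPT : ∀ a, P * T a = T a) {a b : A} (hab : a ≠ b) : T a * T b = 0 := by
  classical
  -- Expanding `T b = T b P T b = ∑ T b T c T b` and cancelling the term `c = b` leaves a vanishing
  -- sum of positive elements.
  have h1 : ∑ c ∈ Finset.univ.erase b, star (T c * T b) * (T c * T b) = 0 := by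
    have h2 : ∀ c, star (T c * T b) * (T c * T b) = T b * T c * T b := fun c => by
      rw [star_mul, (hT c).isSelfAdjoint.star_eq, (hT b).isSelfAdjoint.star_eq, mul_assoc,
        ← mul_assoc (T c), (hT c).isIdempotentElem.eq, mul_assoc]
    have h3 : ∑ c, T b * T c * T b = T b := by
      rw [← Finset.sum_mul, ← Finset.mul_sum, hs, mul_assoc, hPT, (hT b).isIdempotentElem.eq]
    rw [← Finset.add_sum_erase _ _ (Finset.mem_univ b), (hT b).isIdempotentElem.eq,
      (hT b).isIdempotentElem.eq, add_eq_left] at h3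
    rw [← h3]
    exact Finset.sum_congr rfl fun c _ => h2 c
  have h4 := congrArg (Subtype.val : N → H →L[ℂ] H) h1
  rw [AddSubmonoidClass.coe_finsetSum] at h4
  have h5 := (Finset.sum_eq_zero_iff_of_nonneg
    (f := fun c => ((star (T c * T b) * (T c * T b) : N) : H →L[ℂ] H))
    fun c _ => star_mul_self_nonneg_subtype (T c * T b)).1 h4 a (Finset.mem_erase.2 ⟨hab, Finset.mem_univ a⟩)
  exact Subtype.ext (CStarRing.star_mul_self_eq_zero_iff _ |>.1 h5)

end Projections

/-! ### The corner embedding of `M` as a *-homomorphism. -/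

section Corner

variable {M : VonNeumannAlgebra H}

lemma cornerEmb_mul (x y : M) : cornerEmb (x * y) = cornerEmb x * cornerEmb y := by
  have he : InnerProductSpace.rankOne ℂ (basisVec 1) (basisVec 1) *
      InnerProductSpace.rankOne ℂ (basisVec 1) (basisVec 1) =
      InnerProductSpace.rankOne ℂ (basisVec 1) (basisVec 1) := by
    ext1 v
    change InnerProductSpace.rankOne ℂ (basisVec 1) (basisVec 1)
      (InnerProductSpace.rankOne ℂ (basisVec 1) (basisVec 1) v) = _
    simp only [InnerProductSpace.rankOne_apply, inner_smul_right, inner_basisVec_self, mul_one]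
  have h := opTensor_mul (x : H →L[ℂ] H) y (InnerProductSpace.rankOne ℂ (basisVec 1) (basisVec 1))
    (InnerProductSpace.rankOne ℂ (basisVec 1) (basisVec 1))
  rw [he] at h
  exact Subtype.ext h.symm

lemma cornerEmb_star (x : M) : cornerEmb (star x) = star (cornerEmb x) := by
  have h := opTensor_star (x : H →L[ℂ] H)
    (InnerProductSpace.rankOne ℂ (basisVec 1) (basisVec 1))
  rw [ContinuousLinearMap.star_eq_adjoint (InnerProductSpace.rankOne ℂ _ _),
    InnerProductSpace.adjoint_rankOne] at h
  exact Subtype.ext h.symm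

lemma cornerEmb_add (x y : M) : cornerEmb (x + y) = cornerEmb x + cornerEmb y := by
  apply Subtype.ext
  apply opTensor_ext
  intro h v
  change opTensor ((x + y : M) : H →L[ℂ] H) _ _ = opTensor (x : H →L[ℂ] H) _ _ +
    opTensor (y : H →L[ℂ] H) _ _
  rw [opTensor_tmul, opTensor_tmul, opTensor_tmul, ← UniformSpace.Completion.coe_add,
    ← TensorProduct.add_tmul]
  rfl

lemma cornerEmb_injective : Function.Injective (cornerEmb : M → amplification M) :=
  Function.LeftInverse.injective toBase_cornerEmb

/-- The embedding of `M` as a corner, as an additive homomorphism. -/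
def cornerHom (M : VonNeumannAlgebra H) : M →+ amplification M :=
  AddMonoidHom.mk' cornerEmb cornerEmb_add

lemma cornerHom_apply (x : M) : cornerHom M x = cornerEmb x := rfl

lemma isStarProjection_cornerEmb_iff {x : M} :
    IsStarProjection (cornerEmb x) ↔ IsStarProjection x := by
  simp only [isStarProjection_iff, IsIdempotentElem, isSelfAdjoint_iff, ← cornerEmb_mul,
    ← cornerEmb_star, cornerEmb_injective.eq_iff]

lemma isStarProjection_cornerUnit : IsStarProjection (cornerUnit M) :=
  isStarProjection_cornerEmb_iff.2 (.one M)

end Corner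

/-! ### Hilbert–Schmidt inequalities on `M_∞`. -/

namespace TracialState

variable {M : VonNeumannAlgebra H} (τ : TracialState M)

/-- The square of the Hilbert–Schmidt norm on `M_∞`, with values in `[0, ∞]`. -/
def normSq (X : amplification M) : ℝ≥0∞ := τ.traceInf (star X * X)

lemma normSq_star (X : amplification M) : τ.normSq (star X) = τ.normSq X := by
  rw [normSq, star_star, normSq, traceInf_star_mul_self]

lemma normSq_eq_traceInf_of_isStarProjection {X : amplification M} (hX : IsStarProjection X) :
    τ.normSq X = τ.traceInf X := by
  rw [normSq, hX.isSelfAdjoint.star_eq, hX.isIdempotentElem.eq]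

/-- The parallelogram law, with the term of `X - Y` dropped. -/
lemma normSq_add_le (X Y : amplification M) :
    τ.normSq (X + Y) ≤ 2 * τ.normSq X + 2 * τ.normSq Y := by
  have hp := fun Z : amplification M => star_mul_self_nonneg_subtype Z
  have h1 : star (X + Y) * (X + Y) + star (X - Y) * (X - Y) =
      (star X * X + star X * X) + (star Y * Y + star Y * Y) := by
    rw [star_add, star_sub]
    noncomm_ring
  have h2 := τ.traceInf_add (hp (X + Y)) (hp (X - Y))
  have h0 : (0 : amplification M) = 0 + 0 := (add_zero 0).symm
  have hpX : 0 ≤ star X * X + star X * X := h0 ▸ add_le_add_subtype (hp X) (hp X)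
  have hpY : 0 ≤ star Y * Y + star Y * Y := h0 ▸ add_le_add_subtype (hp Y) (hp Y)
  rw [h1, τ.traceInf_add hpX hpY, τ.traceInf_add (hp X) (hp X), τ.traceInf_add (hp Y) (hp Y),
    ← two_mul, ← two_mul] at h2
  exact (le_self_add.trans h2.ge)

lemma normSq_neg (X : amplification M) : τ.normSq (-X) = τ.normSq X := by
  rw [normSq, star_neg, neg_mul_neg, normSq]

lemma normSq_sub_le (X Y : amplification M) :
    τ.normSq (X - Y) ≤ 2 * τ.normSq X + 2 * τ.normSq Y := by
  rw [sub_eq_add_neg, ← τ.normSq_neg Y]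
  exact τ.normSq_add_le X (-Y)

lemma normSq_mul_le (X : amplification M) {Y : amplification M} (hY : Y * star Y ≤ 1) :
    τ.normSq (X * Y) ≤ τ.normSq X := by
  rw [← τ.normSq_star, ← τ.normSq_star X]
  have h := conj_le_conj_subtype hY (star X)
  rw [mul_one] at h
  refine le_trans (le_of_eq ?_) (τ.traceInf_mono h)
  rw [normSq, star_star, star_star, star_mul]
  simp only [mul_assoc]

/-- A Bessel inequality: by traciality the left side is the trace of `X (∑ T a) X*`. It keeps the
later estimates free of the cardinality of `A`. -/
lemma sum_normSq_mul_le {A : Type*} [Fintype A] {T : A → amplification M}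
    (hT : ∀ a, IsStarProjection (T a)) (hs : ∑ a, T a ≤ 1) (X : amplification M) :
    ∑ a, τ.normSq (X * T a) ≤ τ.normSq X := by
  have h1 : ∀ s : Finset A, ∑ a ∈ s, τ.normSq (X * T a) = τ.traceInf (X * (∑ a ∈ s, T a) * star X) ∧
      0 ≤ X * (∑ a ∈ s, T a) * star X := by
    classical
    intro s
    induction s using Finset.induction_on with
    | empty => simp [traceInf_zero]
    | insert a s ha ih =>
      have h2 : star (star (X * T a)) * star (X * T a) = X * T a * star X := by
        rw [star_star, star_mul, (hT a).isSelfAdjoint.star_eq, mul_assoc, ← mul_assoc (T a),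
          (hT a).isIdempotentElem.eq, mul_assoc]
      have h3 : 0 ≤ X * T a * star X := h2 ▸ star_mul_self_nonneg_subtype _
      rw [Finset.sum_insert ha, Finset.sum_insert ha, mul_add, add_mul, τ.traceInf_add h3 ih.2,
        ih.1, ← h2]
      refine ⟨congrArg (· + _) (τ.normSq_star _).symm, ?_⟩
      have := add_le_add_subtype h3 ih.2
      rwa [add_zero, ← h2] at this
  rw [(h1 Finset.univ).1, ← τ.normSq_star X, normSq, star_star]
  refine τ.traceInf_mono ?_
  have h := conj_le_conj_subtype hs (star X)
  rwa [star_star, mul_one] at h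

lemma ofReal_norm₂_sq (x : M) : ENNReal.ofReal (τ.norm₂ x ^ 2) = τ.normSq (cornerEmb x) := by
  rw [norm₂, Real.sq_sqrt (τ.re_nonneg (star_mul_self_nonneg_subtype x)), normSq,
    ← cornerEmb_star, ← cornerEmb_mul, traceInf_cornerEmb]

lemma traceInf_cornerUnit : τ.traceInf (cornerUnit M) = 1 := by
  rw [cornerUnit, traceInf_cornerEmb, τ.map_one', Complex.one_re, ENNReal.ofReal_one]

end TracialState

/-! ### Replacing `w*` by a partial isometry adapted to the measurement. -/

section Rounding

/-- Functional calculus for `t² ≤ t` on `[0, 1]`. -/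
lemma abs_sq_le_abs {x : H →L[ℂ] H} (hx : star x * x ≤ 1) : star x * x ≤ CFC.abs x := by
  have h0 : 0 ≤ CFC.abs x := CFC.abs_nonneg x
  have h1 : CFC.abs x ≤ 1 := by
    have := CFC.monotone_sqrt hx
    rwa [CFC.sqrt_one] at this
  have := CStarAlgebra.pow_antitone h0 h1 (show 1 ≤ 2 by norm_num)
  simpa [CFC.abs_sq] using this

/-- For a partial isometry `w` with final projection below `P = ∑ T a`, some projection `R`
commuting with the `T a` is equivalent to `star w * w`, through a partial isometry `u` close
to `star w * R`. -/
theorem exists_equivalence_of_isPartialIsometry {N : VonNeumannAlgebra H} {A : Type*} [Fintype A]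
    {P w : N} {T : A → N} (hT : ∀ a, IsStarProjection (T a)) (hs : ∑ a, T a = P)
    (hPT : ∀ a, P * T a = T a) (hw : w * star w * w = w) (hPw : P * w = w) :
    ∃ R u : N, IsStarProjection R ∧ P * R = R ∧ star u * u = R ∧ u * star u = star w * w ∧
      (∀ a, T a * R = R * T a) ∧
      star (u - star w * R) * (u - star w * R) ≤ R - R * (w * star w) * R := by
  have hTv : ∀ a, IsStarProjection (T a : H →L[ℂ] H) := fun a =>
    ⟨congrArg Subtype.val (hT a).isIdempotentElem.eq,
      congrArg Subtype.val (hT a).isSelfAdjoint.star_eq⟩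
  have hPv : ∑ a, (T a : H →L[ℂ] H) = P := by
    rw [← hs, AddSubmonoidClass.coe_finsetSum]
  set v := (w : H →L[ℂ] H) with hv
  have hwv : v * star v * v = v := congrArg Subtype.val hw
  have hPwv : (P : H →L[ℂ] H) * v = v := congrArg Subtype.val hPw
  obtain ⟨R, hRN, hR, hTR, hPR, hinj, hspan⟩ := exists_isStarProjection_complement_ker N
    (T := fun a => (T a : H →L[ℂ] H)) (fun a => (T a).2) hTv
    (fun a b hab => congrArg Subtype.val (mul_eq_zero_of_sum_isStarProjection hT hs hPT hab))
    (c := star v) (star_mem w.2) Finset.univ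
  have hRs : star R = R := hR.isSelfAdjoint.star_eq
  have hRR : R * R = R := hR.isIdempotentElem.eq
  rw [hPv] at hPR
  obtain ⟨u, huN, hux, huh, hup, hup', huk, huk'⟩ :=
    exists_polar N (x := star v * R) (mul_mem (star_mem w.2) hRN)
  have hvv : IsStarProjection (star v * v) := by
    refine ⟨?_, IsSelfAdjoint.star_mul_self v⟩
    change _ * _ = _
    rw [mul_assoc, ← mul_assoc v, hwv]
  -- The initial projection of `u` has the kernel of `w*R`, which is `ker R` because `w*` is
  -- injective on the range of `R`.
  have huR : star u * u = R := by
    refine isStarProjection_eq_of_ker_eq hup hR fun z => (huk z).trans ⟨hinj z, fun hz => ?_⟩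
    change star v (R z) = 0
    rw [hz, map_zero]
  have huv : u * star u = star v * v := by
    refine isStarProjection_eq_of_ker_eq hup' hvv fun z => (huk' z).trans ?_
    rw [star_mul, star_star, hRs]
    change R (v z) = 0 ↔ star v (v z) = 0
    constructor
    · intro hz
      -- The maximality clause of the exchange applies to `v z`: if `R` kills it, so does every `T
      -- a`, hence so does `P`, which fixes it.
      have h1 : v z ∈ (star v).kerᗮ := by
        intro k hk
        have hk' : star v k = 0 := hk
        rw [← ContinuousLinearMap.adjoint_inner_left, ← ContinuousLinearMap.star_eq_adjoint, hk',
          inner_zero_left]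
      have h2 := hspan _ h1 hz
      have h3 : (P : H →L[ℂ] H) (v z) = 0 := by
        rw [← hPv, sum_apply]
        exact Finset.sum_eq_zero h2
      have h4 : (P : H →L[ℂ] H) (v z) = v z := congrArg (· z) hPwv
      rw [← h4, h3, map_zero]
    · intro hz
      have h1 : v (star v (v z)) = v z := congrArg (· z) hwv
      rw [← h1, hz, map_zero, map_zero]
  set x := star v * R with hx
  set h := CFC.abs x with hh
  have hhs : star h = h := (CFC.abs_nonneg x).isSelfAdjoint.star_eq
  have hxx : star x * x = R * (v * star v) * R := by
    rw [hx, star_mul, star_star, hRs]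
    simp only [mul_assoc]
  have hx1 : star x * x ≤ 1 := by
    have h1 : v * star v ≤ 1 := by
      refine IsStarProjection.le_one ⟨?_, IsSelfAdjoint.mul_star_self v⟩
      change _ * _ = _
      rw [← mul_assoc, hwv]
    have h2 := star_left_conjugate_le_conjugate h1 R
    rw [hRs, mul_one, hRR] at h2
    rw [hxx]
    exact h2.trans hR.le_one
  have hhx : star x * x ≤ h := abs_sq_le_abs hx1
  refine ⟨⟨R, hRN⟩, ⟨u, huN⟩, ⟨Subtype.ext hRR, Subtype.ext hRs⟩, Subtype.ext hPR,
    Subtype.ext huR, Subtype.ext huv, fun a => Subtype.ext (hTR a), ?_⟩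
  change star (u - x) * (u - x) ≤ R - R * (v * star v) * R
  have h1 : star u * x = h := by rw [← hux, ← mul_assoc, huh]
  have h2 : star x * u = h := by
    have := congrArg star h1
    rwa [star_mul, star_star, hhs] at this
  have h3 : star (u - x) * (u - x) = R - h - h + star x * x := by
    rw [star_sub, sub_mul, mul_sub, mul_sub, huR, h1, h2]
    abel
  -- Since `|u - x|² = R - 2h + x*x`, the claim reduces to `x*x ≤ h`, used twice.
  rw [h3, ← hxx, ← sub_nonneg]
  have h4 : R - star x * x - (R - h - h + star x * x) = (h - star x * x) + (h - star x * x) := by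
    abel
  rw [h4]
  exact add_nonneg (sub_nonneg.2 hhx) (sub_nonneg.2 hhx)

end Rounding

/-! ### Distance between the rounded and the compressed measurements. -/

section Estimates

variable {M : VonNeumannAlgebra H} (τ : TracialState M)

lemma TracialState.traceInf_add_sub {p q : amplification M} (hp : IsStarProjection p)
    (hq : IsStarProjection q) (h : p * q = q) :
    τ.traceInf p = τ.traceInf q + τ.traceInf (p - q) := by
  have h1 := τ.traceInf_add (IsStarProjection.nonneg' hq)
    (IsStarProjection.nonneg' (isStarProjection_sub_of_mul_eq hp hq h))
  rwa [add_sub_cancel] at h1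

lemma isStarProjection_star_mul_self {R : Type*} [Semiring R] [StarRing R] {w : R}
    (hw : w * star w * w = w) : IsStarProjection (star w * w) := by
  refine ⟨?_, IsSelfAdjoint.star_mul_self w⟩
  change _ * _ = _
  rw [mul_assoc, ← mul_assoc w, hw]

lemma isStarProjection_mul_star_self {R : Type*} [Semiring R] [StarRing R] {w : R}
    (hw : w * star w * w = w) : IsStarProjection (w * star w) := by
  refine ⟨?_, IsSelfAdjoint.mul_star_self w⟩
  change _ * _ = _
  rw [← mul_assoc, hw]

lemma mul_eq_self_of_star_mul_self_eq {N : VonNeumannAlgebra H} {u R : N}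
    (hR : IsStarProjection R) (huR : star u * u = R) : u * R = u := by
  have hRR : R * R = R := hR.isIdempotentElem.eq
  have h1 : star (u * R - u) * (u * R - u) = 0 := by
    have h2 : star (u * R - u) * (u * R - u) =
        R * (star u * u) * R - R * (star u * u) - star u * u * R + star u * u := by
      rw [star_sub, star_mul, hR.isSelfAdjoint.star_eq]
      noncomm_ring
    rw [h2, huR, hRR, hRR, sub_self, zero_sub, neg_add_cancel]
  have h2 := CStarRing.star_mul_self_eq_zero_iff ((u * R - u : N) : H →L[ℂ] H) |>.1
    (congrArg Subtype.val h1)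
  exact sub_eq_zero.1 (Subtype.ext h2)

/-- Finiteness of the common trace is what permits cancellation in `[0, ∞]`. -/
lemma TracialState.traceInf_sub_eq_of_traceInf_eq {P p q : amplification M}
    (hP : IsStarProjection P) (hp : IsStarProjection p) (hq : IsStarProjection q)
    (hPp : P * p = p) (hPq : P * q = q) (h : τ.traceInf p = τ.traceInf q)
    (hfin : τ.traceInf q ≠ ⊤) : τ.traceInf (P - p) = τ.traceInf (P - q) := by
  have h1 := τ.traceInf_add_sub hP hp hPp
  rw [h] at h1
  exact (ENNReal.add_right_inj hfin).1 (h1.symm.trans (τ.traceInf_add_sub hP hq hPq))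

/-- Write `u - w* = (u - w*R) - w*(P - R)`. The first piece is controlled by `‖(P - ww*) R‖²` and
the second by the trace of `P - R`; both are at most the trace of `P - ww*`, and the parallelogram
inequality doubles their sum. -/
lemma normSq_sub_star_le {P R u w : amplification M} (hP : IsStarProjection P)
    (hR : IsStarProjection R) (hPR : P * R = R) (hw : w * star w * w = w) (hPw : P * w = w)
    (hfin : τ.traceInf (w * star w) ≠ ⊤) (hRw : τ.traceInf R = τ.traceInf (w * star w))
    (hle : star (u - star w * R) * (u - star w * R) ≤ R - R * (w * star w) * R) :
    τ.normSq (u - star w) ≤ 4 * τ.traceInf (P - w * star w) := by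
  have hRs : star R = R := hR.isSelfAdjoint.star_eq
  have hRR : R * R = R := hR.isIdempotentElem.eq
  have hwP : star w * P = star w := by
    have := congrArg star hPw
    rwa [star_mul, hP.isSelfAdjoint.star_eq] at this
  have hq := isStarProjection_mul_star_self hw
  have hPq : P * (w * star w) = w * star w := by rw [← mul_assoc, hPw]
  have hPRp : IsStarProjection (P - R) := isStarProjection_sub_of_mul_eq hP hR hPR
  have hδR : τ.traceInf (P - R) = τ.traceInf (P - w * star w) :=
    τ.traceInf_sub_eq_of_traceInf_eq hP hR hq hPR hPq hRw hfin
  have h1 : τ.normSq (u - star w * R) ≤ τ.traceInf (P - w * star w) := by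
    refine (τ.traceInf_mono hle).trans ?_
    have hD : IsStarProjection (P - w * star w) := isStarProjection_sub_of_mul_eq hP hq hPq
    have h2 : R - R * (w * star w) * R = star ((P - w * star w) * R) * ((P - w * star w) * R) := by
      rw [star_mul, hRs, hD.isSelfAdjoint.star_eq, ← mul_assoc _ _ R, mul_assoc R _ (P - _),
        hD.isIdempotentElem.eq, mul_sub, sub_mul, mul_assoc R P, hPR, hRR]
    rw [h2, ← τ.normSq_eq_traceInf_of_isStarProjection hD]
    refine τ.normSq_mul_le _ ?_
    rw [hRs, hRR]
    exact IsStarProjection.le_one' hR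
  have h2 : τ.normSq (star w * (P - R)) ≤ τ.traceInf (P - w * star w) := by
    rw [← τ.normSq_star, star_mul, star_star, hPRp.isSelfAdjoint.star_eq, ← hδR,
      ← τ.normSq_eq_traceInf_of_isStarProjection hPRp]
    exact τ.normSq_mul_le _ (IsStarProjection.le_one' hq)
  have h3 : u - star w = (u - star w * R) - star w * (P - R) := by
    rw [mul_sub, hwP]
    abel
  rw [h3]
  refine (τ.normSq_sub_le _ _).trans ((add_le_add (mul_le_mul_right h1 2)
    (mul_le_mul_right h2 2)).trans_eq ?_)
  ring

/-- Telescoping gives `u T u* - w* T w = (u - w*) T u* + ((u - w*) T w)*`. The outer contractions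
`u*` and `w` drop out, and the Bessel inequality sums what remains. -/
lemma sum_normSq_conj_sub_conj_le {A : Type*} [Fintype A] {u w : amplification M}
    {T : A → amplification M} (hT : ∀ a, IsStarProjection (T a)) (hs : ∑ a, T a ≤ 1)
    (hu : star u * u ≤ 1) (hw : w * star w ≤ 1) :
    ∑ a, τ.normSq (u * T a * star u - star w * T a * w) ≤ 4 * τ.normSq (u - star w) := by
  have hu' : star u * star (star u) ≤ 1 := by rwa [star_star]
  have h1 : ∀ a, τ.normSq (u * T a * star u - star w * T a * w) ≤
      4 * τ.normSq ((u - star w) * T a) := by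
    intro a
    have h2 : u * T a * star u - star w * T a * w =
        (u - star w) * T a * star u + star ((u - star w) * T a * w) := by
      rw [star_mul, star_mul, star_sub, star_star, (hT a).isSelfAdjoint.star_eq]
      noncomm_ring
    rw [h2]
    refine (τ.normSq_add_le _ _).trans ?_
    rw [τ.normSq_star]
    refine (add_le_add (mul_le_mul_right (τ.normSq_mul_le _ hu') 2)
      (mul_le_mul_right (τ.normSq_mul_le _ hw) 2)).trans_eq ?_
    ring
  calc _ ≤ ∑ a, 4 * τ.normSq ((u - star w) * T a) := Finset.sum_le_sum fun a _ => h1 a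
    _ = 4 * ∑ a, τ.normSq ((u - star w) * T a) := (Finset.mul_sum _ _ _).symm
    _ ≤ 4 * τ.normSq (u - star w) := mul_le_mul_right (τ.sum_normSq_mul_le hT hs _) 4

/-- An a priori bound that does not see the distance from `u` to `w*`; it serves when `ε` is not
small. -/
lemma sum_normSq_conj_sub_conj_le_add {A : Type*} [Fintype A] {u w : amplification M}
    {T : A → amplification M} (hT : ∀ a, IsStarProjection (T a)) (hs : ∑ a, T a ≤ 1)
    (hu : star u * u ≤ 1) (hw : w * star w ≤ 1) :
    ∑ a, τ.normSq (u * T a * star u - star w * T a * w) ≤ 2 * τ.normSq u + 2 * τ.normSq w := by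
  have hu' : star u * star (star u) ≤ 1 := by rwa [star_star]
  have h1 : ∀ a, τ.normSq (u * T a * star u - star w * T a * w) ≤
      2 * τ.normSq (u * T a) + 2 * τ.normSq (star w * T a) := fun a =>
    (τ.normSq_sub_le _ _).trans (add_le_add (mul_le_mul_right (τ.normSq_mul_le _ hu') 2)
      (mul_le_mul_right (τ.normSq_mul_le _ hw) 2))
  calc _ ≤ ∑ a, (2 * τ.normSq (u * T a) + 2 * τ.normSq (star w * T a)) :=
        Finset.sum_le_sum fun a _ => h1 a
    _ = 2 * ∑ a, τ.normSq (u * T a) + 2 * ∑ a, τ.normSq (star w * T a) := by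
        rw [Finset.sum_add_distrib, Finset.mul_sum, Finset.mul_sum]
    _ ≤ 2 * τ.normSq u + 2 * τ.normSq w := by
        rw [← τ.normSq_star w]
        exact add_le_add (mul_le_mul_right (τ.sum_normSq_mul_le hT hs u) 2)
          (mul_le_mul_right (τ.sum_normSq_mul_le hT hs (star w)) 2)

/-- Commutation of `p` with the initial projection `r` turns the middle factor `p u*u p` into `r p`,
and `u` absorbs `r`. -/
lemma isStarProjection_conj {R : Type*} [Semiring R] [StarRing R] {u r p : R}
    (hp : IsStarProjection p) (hu : star u * u = r) (hur : u * r = u) (hrp : p * r = r * p) :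
    IsStarProjection (u * p * star u) := by
  refine ⟨?_, ?_⟩
  · change u * p * star u * (u * p * star u) = u * p * star u
    calc u * p * star u * (u * p * star u)
        = u * (p * (star u * u) * p) * star u := by simp only [mul_assoc]
      _ = u * r * p * star u := by
          rw [hu, hrp, mul_assoc r, hp.isIdempotentElem.eq, ← mul_assoc]
      _ = u * p * star u := by rw [hur]
  · rw [isSelfAdjoint_iff, star_mul, star_mul, star_star, hp.isSelfAdjoint.star_eq, mul_assoc]

/-- Projections `T a` with sum `P`, compressed by a partial isometry `w`, are close in the
Hilbert–Schmidt norm to projections `u * T a * star u` with sum `star w * w`. -/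
theorem exists_rounding {A : Type*} [Fintype A] {P w : amplification M}
    {T : A → amplification M} (hP : IsStarProjection P) (hT : ∀ a, IsStarProjection (T a))
    (hs : ∑ a, T a = P) (hPT : ∀ a, P * T a = T a) (hw : w * star w * w = w) (hPw : P * w = w)
    (hfin : τ.traceInf (star w * w) ≤ 1) :
    ∃ u : amplification M, u * star u = star w * w ∧ u * star u * u = u ∧ u * P = u ∧
      (∀ a, IsStarProjection (u * T a * star u)) ∧
      ∑ a, τ.normSq (u * T a * star u - star w * T a * w) ≤ 16 * τ.traceInf (P - w * star w) ∧
      ∑ a, τ.normSq (u * T a * star u - star w * T a * w) ≤ 4 := by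
  obtain ⟨R, u, hR, hPR, huR, huw, hTR, hle⟩ :=
    exists_equivalence_of_isPartialIsometry hT hs hPT hw hPw
  have huRu : u * R = u := mul_eq_self_of_star_mul_self_eq hR huR
  have hRP : R * P = R := by
    have := congrArg star hPR
    rwa [star_mul, hR.isSelfAdjoint.star_eq, hP.isSelfAdjoint.star_eq] at this
  have hqp : τ.traceInf (w * star w) = τ.traceInf (star w * w) :=
    (τ.traceInf_star_mul_self w).symm
  have hRq : τ.traceInf R = τ.traceInf (w * star w) := by
    rw [← huR, τ.traceInf_star_mul_self, huw, hqp]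
  have hs1 : ∑ a, T a ≤ 1 := hs ▸ IsStarProjection.le_one' hP
  have hww : w * star w ≤ 1 := IsStarProjection.le_one' (isStarProjection_mul_star_self hw)
  have huu : star u * u ≤ 1 := huR ▸ IsStarProjection.le_one' hR
  refine ⟨u, huw, ?_, ?_, fun a => isStarProjection_conj (hT a) huR huRu (hTR a), ?_, ?_⟩
  · rw [mul_assoc, huR, huRu]
  · rw [← huRu, mul_assoc, hRP]
  · have hfin' : τ.traceInf (w * star w) ≠ ⊤ :=
      hqp ▸ ne_top_of_le_ne_top ENNReal.one_ne_top hfin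
    refine (sum_normSq_conj_sub_conj_le τ hT hs1 huu hww).trans ((mul_le_mul_right
      (normSq_sub_star_le τ hP hR hPR hw hPw hfin' hRq hle) 4).trans_eq ?_)
    ring
  · have h2 : τ.normSq u ≤ 1 := by rwa [TracialState.normSq, huR, hRq, hqp]
    refine (sum_normSq_conj_sub_conj_le_add τ hT hs1 huu hww).trans
      ((add_le_add (mul_le_mul_right h2 2) (mul_le_mul_right hfin 2)).trans_eq ?_)
    norm_num

end Estimates

/-! ### Completion to a measurement on `M`, and the final constant. -/

section Main

variable {M : VonNeumannAlgebra H} (τ : TracialState M)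

lemma cornerEmb_toBase_of_mul_eq {X : amplification M} (h : cornerUnit M * X = X)
    (h' : X * cornerUnit M = X) : cornerEmb (toBase X) = X := by
  rw [cornerEmb_toBase, h, h']

lemma normSq_add_of_mul_eq_zero {X Y : amplification M} (h : star X * Y = 0) :
    τ.normSq (X + Y) = τ.normSq X + τ.normSq Y := by
  have h' : star Y * X = 0 := by
    have := congrArg star h
    rwa [star_mul, star_star, star_zero] at this
  rw [TracialState.normSq, star_add, add_mul, mul_add, mul_add, h, h', add_zero, zero_add,
    τ.traceInf_add (star_mul_self_nonneg_subtype X) (star_mul_self_nonneg_subtype Y)]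
  rfl

/-- A numerical estimate: a defect `d` of relative size at most `ε` in a total mass `m ≤ 1 + d`. -/
lemma toReal_le_of_div_le {d m r s : ℝ≥0∞} {ε : ℝ} (hm : m ≠ ⊤) (hmr : m = r + d) (hr : r ≤ 1)
    (hε : 0 ≤ ε) (hd : (d / m).toReal ≤ ε) (hs : s ≤ 16 * d) (hs' : s ≤ 4) :
    s.toReal + ε ≤ 56 * ε := by
  have hs4 : s.toReal ≤ 4 := by
    have := ENNReal.toReal_mono (by simp) hs'
    simpa using this
  -- For `ε ≥ 1/2`, `s ≤ 4 ≤ 8ε` gives a total of `9ε`. Otherwise `m ≤ 1 + εm` gives `m ≤ 2`, so `s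
  -- ≤ 16d ≤ 32ε` and the total is at most `33ε`.
  rcases le_or_gt (1 / 2) ε with h | h
  · linarith
  · have hdm : d ≤ m := hmr ▸ le_add_self
    have hdt : d ≠ ⊤ := ne_top_of_le_ne_top hm hdm
    have hrt : r ≠ ⊤ := ne_top_of_le_ne_top ENNReal.one_ne_top hr
    have h1 : m.toReal = r.toReal + d.toReal := by rw [hmr, ENNReal.toReal_add hrt hdt]
    have h2 : r.toReal ≤ 1 := by simpa using ENNReal.toReal_mono ENNReal.one_ne_top hr
    have h3 : s.toReal ≤ 16 * d.toReal := by
      have := ENNReal.toReal_mono (ENNReal.mul_ne_top (by simp) hdt) hs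
      simpa using this
    have h4 : d.toReal ≤ ε * m.toReal := by
      rw [ENNReal.toReal_div] at hd
      -- When `m` is zero the quotient says nothing, but `d ≤ m` already makes `d` vanish.
      rcases eq_or_lt_of_le (ENNReal.toReal_nonneg (a := m)) with h0 | h0
      · have := ENNReal.toReal_mono hm hdm
        rw [← h0] at this ⊢
        simpa using this
      · rwa [div_le_iff₀ h0] at hd
    have h5 : m.toReal ≤ 2 := by nlinarith [ENNReal.toReal_nonneg (a := m)]
    nlinarith

lemma cornerEmb_toBase_mul_mul {p X Y Z : amplification M} (hIp : cornerUnit M * p = p)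
    (hpI : p * cornerUnit M = p) (hX : p * X = X) (hZ : Z * p = Z) :
    cornerEmb (toBase (X * Y * Z)) = X * Y * Z := by
  refine cornerEmb_toBase_of_mul_eq ?_ ?_
  · rw [← mul_assoc, ← mul_assoc, ← hX, ← mul_assoc, hIp]
  · rw [← hZ, mul_assoc, mul_assoc Z, hpI]

lemma cornerEmb_sub (x y : M) : cornerEmb (x - y) = cornerEmb x - cornerEmb y :=
  (cornerHom M).map_sub x y

/-- Complete projections `u * T a * star u` with sum `p` to a projective measurement, by adding
the complement of `p` to one of them. -/
lemma exists_isProjectiveMeasurement {A : Type*} [Fintype A] [DecidableEq A]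
    {p u P : amplification M} {T : A → amplification M} (hp : IsStarProjection p)
    (hIp : cornerUnit M * p = p) (hpI : p * cornerUnit M = p) (hpu : p * u = u)
    (huu : u * star u = p) (huP : u * P = u) (hs : ∑ a, T a = P)
    (hQ : ∀ a, IsStarProjection (u * T a * star u)) (a₀ : A) :
    ∃ Q : A → M, IsProjectiveMeasurement 1 Q ∧
      ∀ a, cornerEmb (Q a) = u * T a * star u + if a = a₀ then cornerUnit M - p else 0 := by
  have hup : star u * p = star u := by
    have := congrArg star hpu
    rwa [star_mul, hp.isSelfAdjoint.star_eq] at this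
  have h1p : cornerEmb (1 - toBase p) = cornerUnit M - p := by
    rw [cornerEmb_sub, cornerEmb_toBase_of_mul_eq hIp hpI]
    rfl
  have hIpp : IsStarProjection (cornerUnit M - p) :=
    isStarProjection_sub_of_mul_eq isStarProjection_cornerUnit hp hIp
  have hQc : ∀ a, cornerEmb (toBase (u * T a * star u) + if a = a₀ then 1 - toBase p else 0) =
      u * T a * star u + if a = a₀ then cornerUnit M - p else 0 := fun a => by
    rw [cornerEmb_add, cornerEmb_toBase_mul_mul hIp hpI hpu hup]
    congr 1
    split_ifs
    · exact h1p
    · exact (cornerHom M).map_zero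
  refine ⟨_, ⟨fun a => ⟨_, by rw [one_mul, mul_one]⟩, fun a => ?_, ?_⟩, hQc⟩
  · rw [← isStarProjection_cornerEmb_iff, hQc]
    split_ifs
    · refine (hQ a).add hIpp ?_
      rw [← hup, ← mul_assoc, mul_assoc _ p, mul_sub, hpI, hp.isIdempotentElem.eq, sub_self,
        mul_zero]
    · rw [add_zero]
      exact hQ a
  · apply cornerEmb_injective
    refine (map_sum (cornerHom M) _ Finset.univ).trans ?_
    simp only [cornerHom_apply, hQc]
    rw [Finset.sum_add_distrib, ← Finset.sum_mul, ← Finset.mul_sum, hs, huP, huu,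
      Finset.sum_ite_eq' Finset.univ a₀, if_pos (Finset.mem_univ _), add_sub_cancel]
    rfl

/-- The difference `u t u* - w* t w` has range under `p`, while `x` is annihilated by `p`.
Orthogonality makes the squared norms add exactly, so the completion costs no factor of two. -/
lemma ofReal_norm₂_sub_toBase_sq {p u w t x : amplification M} {y : M} (hp : IsStarProjection p)
    (hIp : cornerUnit M * p = p) (hpI : p * cornerUnit M = p) (hpu : p * u = u)
    (hpw : p * star w = star w) (hwp : w * p = w) (hx : x = cornerUnit M - p ∨ x = 0)
    (hy : cornerEmb y = u * t * star u + x) :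
    ENNReal.ofReal (τ.norm₂ (y - toBase (star w * t * w)) ^ 2) =
      τ.normSq (u * t * star u - star w * t * w) + τ.traceInf x := by
  have hpX : p * (u * t * star u - star w * t * w) = u * t * star u - star w * t * w := by
    rw [mul_sub, ← mul_assoc, ← mul_assoc, ← mul_assoc, ← mul_assoc, hpu, hpw]
  rw [τ.ofReal_norm₂_sq, cornerEmb_sub, hy, cornerEmb_toBase_mul_mul hIp hpI hpw hwp,
    add_sub_right_comm, normSq_add_of_mul_eq_zero]
  · rcases hx with rfl | rfl
    · rw [τ.normSq_eq_traceInf_of_isStarProjection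
        (isStarProjection_sub_of_mul_eq isStarProjection_cornerUnit hp hIp)]
    · rw [τ.normSq_eq_traceInf_of_isStarProjection (.zero _)]
  · rw [← hpX, star_mul, hp.isSelfAdjoint.star_eq, mul_assoc]
    rcases hx with rfl | rfl
    · rw [mul_sub, hpI, hp.isIdempotentElem.eq, sub_self, mul_zero]
    · rw [mul_zero, mul_zero]

/-- Projections with finite sum `P`, compressed to `M` by a partial isometry `w`, are close to a
projective measurement on `M`. -/
theorem exists_isProjectiveMeasurement_sum_le {A : Type*} [Fintype A] [Nonempty A]
    {P w : amplification M} {T : A → amplification M} (hP : IsStarProjection P)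
    (hT : ∀ a, IsStarProjection (T a)) (hs : ∑ a, T a = P) (hPT : ∀ a, P * T a = T a)
    (hw : w * star w * w = w) (hPw : P * w = w) (hwI : w * cornerUnit M = w) :
    ∃ Q : A → M, IsProjectiveMeasurement 1 Q ∧ ∃ s : ℝ≥0∞,
      s ≤ 16 * τ.traceInf (P - w * star w) ∧ s ≤ 4 ∧ τ.traceInf (star w * w) ≤ 1 ∧
      ENNReal.ofReal (∑ a, τ.norm₂ (Q a - toBase (star w * T a * w)) ^ 2) =
        s + τ.traceInf (cornerUnit M - star w * w) := by
  classical
  have hI := isStarProjection_cornerUnit (M := M)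
  have hIw : cornerUnit M * star w = star w := by
    have := congrArg star hwI
    rwa [star_mul, hI.isSelfAdjoint.star_eq] at this
  obtain ⟨p, hpw⟩ : ∃ p, star w * w = p := ⟨_, rfl⟩
  have hp : IsStarProjection p := hpw ▸ isStarProjection_star_mul_self hw
  have hIp : cornerUnit M * p = p := by rw [← hpw, ← mul_assoc, hIw]
  have hpI : p * cornerUnit M = p := by rw [← hpw, mul_assoc, hwI]
  have hwp : w * p = w := by rw [← hpw, ← mul_assoc, hw]
  have hpw' : p * star w = star w := by
    have := congrArg star hwp
    rwa [star_mul, hp.isSelfAdjoint.star_eq] at this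
  have hp1 : τ.traceInf (star w * w) ≤ 1 := by
    rw [hpw, ← τ.traceInf_cornerUnit, τ.traceInf_add_sub hI hp hIp]
    exact le_self_add
  obtain ⟨u, huu, huu', huP, hQ, h16, h4⟩ := exists_rounding τ hP hT hs hPT hw hPw hp1
  rw [hpw] at huu ⊢
  have hpu : p * u = u := by rw [← huu, huu']
  obtain ⟨Q, hQm, hQc⟩ := exists_isProjectiveMeasurement hp hIp hpI hpu huu huP hs hQ
    (Classical.arbitrary A)
  refine ⟨Q, hQm, _, h16, h4, hpw ▸ hp1, ?_⟩
  rw [ENNReal.ofReal_sum_of_nonneg fun a _ => sq_nonneg _, Finset.sum_congr rfl fun a _ =>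
    ofReal_norm₂_sub_toBase_sq τ hp hIp hpI hpu hpw' hwp (ite_eq_or_eq _ _ _) (hQc a),
    Finset.sum_add_distrib]
  simp only [apply_ite τ.traceInf, τ.traceInf_zero]
  rw [Finset.sum_ite_eq' Finset.univ, if_pos (Finset.mem_univ _)]

end Main

end

end TracialVN

theorem mainTheorem7 {H : Type*} [NormedAddCommGroup H] [InnerProductSpace ℂ H] [CompleteSpace H]
    (M : VonNeumannAlgebra H) (τ : TracialVN.TracialState M)
    (P : TracialVN.amplification M) (hP : IsStarProjection P) (hP0 : P ≠ 0)
    (hPfin : τ.traceInf P ≠ ⊤)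
    (w : TracialVN.amplification M) (hw : TracialVN.IsPartialIsometry w)
    (hwmem : w ∈ TracialVN.compressSet P (TracialVN.cornerUnit M))
    (ε : ℝ)
    (hε : ε = max (τ (1 - TracialVN.toBase (star w * w))).re
      (τ.traceInf (P - w * star w) / τ.traceInf P).toReal)
    {A : Type*} [Fintype A] (T : A → TracialVN.amplification M)
    (hT : TracialVN.IsProjectiveMeasurement P T) :
    ∃ Q : A → M, TracialVN.IsProjectiveMeasurement 1 Q ∧
      ∑ a, τ.norm₂ (Q a - TracialVN.toBase (star w * T a * w)) ^ 2 ≤ 56 * ε := by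
  have hw' : w * star w * w = w := hw
  have hPw : P * w = w := by
    obtain ⟨Y, rfl⟩ := hwmem
    rw [← mul_assoc, ← mul_assoc, hP.isIdempotentElem.eq]
  have hI := TracialVN.isStarProjection_cornerUnit (M := M)
  have hwI : w * TracialVN.cornerUnit M = w := by
    obtain ⟨Y, rfl⟩ := hwmem
    rw [mul_assoc, hI.isIdempotentElem.eq]
  have hPT : ∀ a, P * T a = T a := fun a => by
    obtain ⟨Y, hY⟩ := hT.mem a
    rw [hY, ← mul_assoc, ← mul_assoc, hP.isIdempotentElem.eq]
  -- An outcome is needed to receive `I_M - w*w`; an empty measurement would sum to `0 ≠ P`.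
  have hne : Nonempty A := by
    by_contra h
    rw [not_nonempty_iff] at h
    exact hP0 (by rw [← hT.sum_eq, Finset.univ_eq_empty, Finset.sum_empty])
  obtain ⟨Q, hQ, s, h16, h4, hp1, hsum⟩ := TracialVN.exists_isProjectiveMeasurement_sum_le τ hP
    hT.proj hT.sum_eq hPT hw' hPw hwI
  have hε0 : 0 ≤ ε := hε ▸ le_max_of_le_right ENNReal.toReal_nonneg
  have hεp : τ.traceInf (TracialVN.cornerUnit M - star w * w) ≤ ENNReal.ofReal ε := by
    have hIw : TracialVN.cornerUnit M * star w = star w := by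
      have := congrArg star hwI
      rwa [star_mul, hI.isSelfAdjoint.star_eq] at this
    have h1p : TracialVN.cornerEmb (1 - TracialVN.toBase (star w * w)) =
        TracialVN.cornerUnit M - star w * w := by
      rw [TracialVN.cornerEmb_sub, TracialVN.cornerEmb_toBase_of_mul_eq
        (by rw [← mul_assoc, hIw]) (by rw [mul_assoc, hwI])]
      rfl
    rw [← h1p, τ.traceInf_cornerEmb]
    exact ENNReal.ofReal_le_ofReal (hε ▸ le_max_left _ _)
  refine ⟨Q, hQ, ?_⟩
  have hst : s ≠ ⊤ := ne_top_of_le_ne_top (by simp) h4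
  have hle : ENNReal.ofReal (∑ a, τ.norm₂ (Q a - TracialVN.toBase (star w * T a * w)) ^ 2) ≤
      ENNReal.ofReal (s.toReal + ε) := by
    rw [hsum, ENNReal.ofReal_add ENNReal.toReal_nonneg hε0, ENNReal.ofReal_toReal hst]
    exact add_le_add le_rfl hεp
  refine ((ENNReal.ofReal_le_ofReal_iff (add_nonneg ENNReal.toReal_nonneg hε0)).1 hle).trans ?_
  refine TracialVN.toReal_le_of_div_le hPfin (r := τ.traceInf (star w * w)) ?_ hp1 hε0
    (hε ▸ le_max_right _ _) h16 h4
  rw [τ.traceInf_add_sub hP (TracialVN.isStarProjection_mul_star_self hw')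
    (by rw [← mul_assoc, hPw]), τ.traceInf_star_mul_self w]
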